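/- Let $c\neq 0$ be a real number and let $\tilde M^2_1(4c)$ be a Lorentzian complex space form of complex dimension $2$: a smooth manifold of real dimension $4$ with a pseudo-Riemannian metric $\langle\,,\rangle$ and an almost complex structure $J$ which is orthogonal for the metric and parallel for its Levi-Civita connection, of complex index $1$ (the largest $J$-invariant negative definite subspace of each tangent space has complex dimension $1$), whose curvature tensor is $$\tilde R(X,Y)Z=c\{\langle Y,Z\rangle X-\langle X,Z\rangle Y+\langle JY,Z\rangle JX-\langle JX,Z\rangle JY+2\langle X,JY\rangle JZ\}.$$ Let $M$ be a nonempty surface immersed in $\tilde M^2_1(4c)$ whose induced metric $g$ is Lorentzian (nondegenerate of index $1$), and let $PX$ denote the tangential component of $JX$ for $X$ tangent to $M$. For a real number $\theta$, $M$ is called slant with slant angle $\theta$ if every tangent plane of $M$ has a basis $e_1,e_2$ with $\langle e_1,e_1\rangle=\langle e_2,e_2\rangle=0$, $\langle e_1,e_2\rangle=-1$ and $$Pe_1=(\sinh\theta)\,e_1,\qquad Pe_2=-(\sinh\theta)\,e_2,$$ and Lagrangian if $J$ maps every tangent space of $M$ into the normal space. Suppose that $M$ is minimal (its mean curvature vector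 vanishes at every point) and flat (the curvature tensor of $g$ vanishes). Then, for every real $\theta$, $M$ is slant with slant angle $\theta$ if and only if $\theta=0$ and $M$ is Lagrangian. In particular, the minimal flat slant surfaces in $\tilde M^2_1(4c)$ with $c\neq0$ are exactly the minimal flat Lagrangian ones. -/

import Mathlib

open scoped Manifold ContDiff

noncomputable section

namespace LorentzSurface

/-! ## Pseudo-Riemannian geometry of a coordinate domain

`G` is a metric tensor in coordinates: for `y` in an open subset of the model space `E`,
`G y` is the bilinear form whose values on basis vectors are the coefficients `g_ij(y)`. -/

section Coordinates

variable {E : Type*} [NormedAddCommGroup E] [NormedSpace ℝ E]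

/-- The Levi-Civita connection of `G` on constant (coordinate) vector fields: `∇_u v` at `y`.
It is the Koszul (Christoffel) formula
`2 ⟨∇_u v, w⟩ = (∂_u G)(v, w) + (∂_v G)(u, w) - (∂_w G)(u, v)`
solved with the inverse of the metric, `(G y)⁻¹ : E* → E` (raising the index). -/
def christoffel (G : E → E →L[ℝ] E →L[ℝ] ℝ) (y u v : E) : E :=
  (G y).inverse ((2⁻¹ : ℝ) •
    (fderiv ℝ G y u v + fderiv ℝ G y v u - ((fderiv ℝ G y).flip u).flip v))

/-- The Riemann curvature tensor `R(u, v) w = ∇_u ∇_v w - ∇_v ∇_u w` of `G` at `y`, on constant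
(hence commuting) coordinate vector fields. -/
def curvature (G : E → E →L[ℝ] E →L[ℝ] ℝ) (y u v w : E) : E :=
  fderiv ℝ (fun z => christoffel G z v w) y u - fderiv ℝ (fun z => christoffel G z u w) y v
    + christoffel G y u (christoffel G y v w) - christoffel G y v (christoffel G y u w)

/-- The covariant derivative `(∇_u J) v = ∇_u (J v) - J (∇_u v)` at `y` of a field of
endomorphisms `J`. -/
def covDerivEndo (G : E → E →L[ℝ] E →L[ℝ] ℝ) (J : E → E →L[ℝ] E) (y u v : E) : E :=
  fderiv ℝ J y u v + christoffel G y u (J y v) - J y (christoffel G y u v)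

/-- The trace `∑ g^{ij} h(b_i, b_j)` of `h` with respect to the nondegenerate bilinear form `B`,
written as `∑ h(b_i, ♯b^i)` with `b^i` the dual basis and `♯ = B⁻¹ : E* → E`. -/
def metricTrace [FiniteDimensional ℝ E] {F : Type*} [AddCommGroup F]
    (B : E →L[ℝ] E →L[ℝ] ℝ) (h : E → E → F) : F :=
  ∑ i, h (Module.finBasis ℝ E i)
    (B.inverse (LinearMap.toContinuousLinearMap ((Module.finBasis ℝ E).coord i)))

variable {E' : Type*} [NormedAddCommGroup E'] [NormedSpace ℝ E']

/-- The second fundamental form at `y`, by the formula of Gauss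
`h(u, v) = ∇̃_u v - ∇_u v`, of the map `F` between coordinate domains with metrics `G` (source)
and `G'` (target):
`∂_u ∂_v F + Γ'(∂_u F, ∂_v F) - dF (Γ(u, v))`. -/
def secondFundamentalForm (G : E → E →L[ℝ] E →L[ℝ] ℝ) (G' : E' → E' →L[ℝ] E' →L[ℝ] ℝ)
    (F : E → E') (y u v : E) : E' :=
  fderiv ℝ (fun z => fderiv ℝ F z v) y u
    + christoffel G' (F y) (fderiv ℝ F y u) (fderiv ℝ F y v)
    - fderiv ℝ F y (christoffel G y u v)

/-- The mean curvature vector `H = (1 / dim) trace h` of `F` at `y`. -/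
def meanCurvature [FiniteDimensional ℝ E] (G : E → E →L[ℝ] E →L[ℝ] ℝ)
    (G' : E' → E' →L[ℝ] E' →L[ℝ] ℝ) (F : E → E') (y : E) : E' :=
  (Module.finrank ℝ E : ℝ)⁻¹ • metricTrace (G y) (secondFundamentalForm G G' F y)

end Coordinates

/-! ## Tensor fields on a manifold -/

section Manifold

variable {E : Type*} [NormedAddCommGroup E] [NormedSpace ℝ E]

/-- A field of bilinear forms on the tangent spaces of `M` (no regularity yet). -/
abbrev BilinField (E : Type*) [NormedAddCommGroup E] [NormedSpace ℝ E]
    (M : Type*) [TopologicalSpace M] [ChartedSpace E M] : Type _ :=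
  ∀ x : M, TangentSpace 𝓘(ℝ, E) x →L[ℝ] TangentSpace 𝓘(ℝ, E) x →L[ℝ] ℝ

/-- A field of endomorphisms of the tangent spaces of `M` (no regularity yet). -/
abbrev EndoField (E : Type*) [NormedAddCommGroup E] [NormedSpace ℝ E]
    (M : Type*) [TopologicalSpace M] [ChartedSpace E M] : Type _ :=
  ∀ x : M, TangentSpace 𝓘(ℝ, E) x →L[ℝ] TangentSpace 𝓘(ℝ, E) x

/-- The smooth charts of the manifold `M`. -/
abbrev charts (E : Type*) [NormedAddCommGroup E] [NormedSpace ℝ E]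
    (M : Type*) [TopologicalSpace M] [ChartedSpace E M] : Set (OpenPartialHomeomorph M E) :=
  IsManifold.maximalAtlas 𝓘(ℝ, E) ∞ M

variable {M : Type*} [TopologicalSpace M] [ChartedSpace E M]

/-- The bilinear form `(u, v) ↦ B (A u) (A v)`. -/
def pullForm {V W : Type*} [AddCommGroup V] [Module ℝ V] [TopologicalSpace V]
    [IsTopologicalAddGroup V] [ContinuousSMul ℝ V] [AddCommGroup W] [Module ℝ W]
    [TopologicalSpace W] [IsTopologicalAddGroup W] [ContinuousSMul ℝ W]
    (B : W →L[ℝ] W →L[ℝ] ℝ) (A : V →L[ℝ] W) : V →L[ℝ] V →L[ℝ] ℝ :=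
  (A.precomp ℝ).comp (B.comp A)

theorem pullForm_apply {V W : Type*} [AddCommGroup V] [Module ℝ V] [TopologicalSpace V]
    [IsTopologicalAddGroup V] [ContinuousSMul ℝ V] [AddCommGroup W] [Module ℝ W]
    [TopologicalSpace W] [IsTopologicalAddGroup W] [ContinuousSMul ℝ W]
    (B : W →L[ℝ] W →L[ℝ] ℝ) (A : V →L[ℝ] W) (u v : V) :
    pullForm B A u v = B (A u) (A v) := rfl

/-- The coordinate expression of `g` in the chart `e`; meaningful on `e.target`. -/
def BilinField.inChart (g : BilinField E M) (e : OpenPartialHomeomorph M E) (y : E) :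
    E →L[ℝ] E →L[ℝ] ℝ :=
  pullForm (g (e.symm y)) (mfderiv 𝓘(ℝ, E) 𝓘(ℝ, E) e.symm y)

/-- The coordinate expression of `J` in the chart `e`; meaningful on `e.target`. -/
def EndoField.inChart (J : EndoField E M) (e : OpenPartialHomeomorph M E) (y : E) :
    E →L[ℝ] E :=
  (mfderiv 𝓘(ℝ, E) 𝓘(ℝ, E) e (e.symm y)).comp
    ((J (e.symm y)).comp (mfderiv 𝓘(ℝ, E) 𝓘(ℝ, E) e.symm y))

/-- `g` is a (smooth) pseudo-Riemannian metric on `M`. -/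
structure IsPseudoRiemannian (g : BilinField E M) : Prop where
  symm : ∀ x u v, g x u v = g x v u
  nondegenerate : ∀ x u, (∀ v, g x u v = 0) → u = 0
  smooth : ∀ e ∈ charts E M, ContDiffOn ℝ ∞ (g.inChart e) e.target

/-- The subspace `W` of the tangent space at `x` is negative definite. -/
def IsNegDef (g : BilinField E M) (x : M) (W : Submodule ℝ (TangentSpace 𝓘(ℝ, E) x)) : Prop :=
  ∀ u ∈ W, u ≠ 0 → g x u u < 0

/-- `g` is Lorentzian: its index, the largest dimension of a negative definite subspace of a
tangent space, is `1` everywhere. -/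
def HasIndexOne (g : BilinField E M) : Prop :=
  ∀ x, (∃ W, IsNegDef g x W ∧ Module.finrank ℝ W = 1) ∧
    ∀ W, IsNegDef g x W → Module.finrank ℝ W ≤ 1

/-- The metric `g` is flat. -/
def IsFlat (g : BilinField E M) : Prop :=
  ∀ e ∈ charts E M, ∀ y ∈ e.target, ∀ u v w : E, curvature (g.inChart e) y u v w = 0

/-- `(M, g, J)` is an (indefinite) Kähler manifold: `J` is a smooth almost complex structure,
orthogonal for the pseudo-Riemannian metric `g` and parallel for its Levi-Civita connection. -/
structure IsKahler (g : BilinField E M) (J : EndoField E M) : Prop where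
  metric : IsPseudoRiemannian g
  sq : ∀ x u, J x (J x u) = -u
  orthogonal : ∀ x u v, g x (J x u) (J x v) = g x u v
  smooth : ∀ e ∈ charts E M, ContDiffOn ℝ ∞ (J.inChart e) e.target
  parallel : ∀ e ∈ charts E M, ∀ y ∈ e.target, ∀ u v : E,
    covDerivEndo (g.inChart e) (J.inChart e) y u v = 0

/-- The complex index of `(g, J)` is `i`: at every point, the largest complex (that is,
`J`-invariant) negative definite subspace of the tangent space has complex dimension `i`
(real dimension `2 * i`). -/
def HasComplexIndex (g : BilinField E M) (J : EndoField E M) (i : ℕ) : Prop :=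
  ∀ x, (∃ W, IsNegDef g x W ∧ (∀ u ∈ W, J x u ∈ W) ∧ Module.finrank ℝ W = 2 * i) ∧
    ∀ W, IsNegDef g x W → (∀ u ∈ W, J x u ∈ W) → Module.finrank ℝ W ≤ 2 * i

/-- `(M, g, J)` is a Lorentzian complex space form of constant holomorphic sectional curvature
`4c`: an indefinite Kähler manifold of complex index one with curvature tensor
`R(u,v)w = c (⟨v,w⟩u - ⟨u,w⟩v + ⟨Jv,w⟩Ju - ⟨Ju,w⟩Jv + 2⟨u,Jv⟩Jw)`. -/
structure IsLorentzianComplexSpaceForm (g : BilinField E M) (J : EndoField E M) (c : ℝ) :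
    Prop where
  kahler : IsKahler g J
  complexIndex : HasComplexIndex g J 1
  curvature_eq : ∀ e ∈ charts E M, ∀ y ∈ e.target, ∀ u v w : E,
    curvature (g.inChart e) y u v w = c •
      (g.inChart e y v w • u - g.inChart e y u w • v
        + g.inChart e y (J.inChart e y v) w • J.inChart e y u
        - g.inChart e y (J.inChart e y u) w • J.inChart e y v
        + (2 * g.inChart e y u (J.inChart e y v)) • J.inChart e y w)

/-! ## Submanifolds -/

variable {E' : Type*} [NormedAddCommGroup E'] [NormedSpace ℝ E']
  {N : Type*} [TopologicalSpace N] [ChartedSpace E' N]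

/-- The metric induced on `M` by `f : M → N`. -/
def inducedMetric (g : BilinField E' N) (f : M → N) : BilinField E M := fun x =>
  pullForm (g (f x)) (mfderiv 𝓘(ℝ, E) 𝓘(ℝ, E') f x)

/-- `f : M → N` is a smooth immersion whose induced metric is nondegenerate of index one. -/
structure IsLorentzianImmersion (g : BilinField E' N) (f : M → N) : Prop where
  smooth : ContMDiff 𝓘(ℝ, E) 𝓘(ℝ, E') ∞ f
  immersion : ∀ x, Function.Injective (mfderiv 𝓘(ℝ, E) 𝓘(ℝ, E') f x)
  nondegenerate : ∀ x u, (∀ v, inducedMetric (E := E) g f x u v = 0) → u = 0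
  index : HasIndexOne (inducedMetric (E := E) g f)

/-- `f` is minimal: its mean curvature vector vanishes at each point (computed in any charts
`e` of `M` and `e'` of `N` around the point and its image). -/
def IsMinimal [FiniteDimensional ℝ E] (g : BilinField E' N) (f : M → N) : Prop :=
  ∀ e ∈ charts E M, ∀ e' ∈ charts E' N, ∀ y ∈ e.target, f (e.symm y) ∈ e'.source →
    meanCurvature ((inducedMetric (E := E) g f).inChart e) (g.inChart e')
      (fun z => e' (f (e.symm z))) y = 0

/-- `a` is `P u`, the tangential component of `J u`: the vector `J (df u) - df a` is normal. -/
def IsTangentialPart (g : BilinField E' N) (J : EndoField E' N) (f : M → N) (x : M)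
    (u a : TangentSpace 𝓘(ℝ, E) x) : Prop :=
  ∀ w : TangentSpace 𝓘(ℝ, E) x,
    g (f x) (J (f x) (mfderiv 𝓘(ℝ, E) 𝓘(ℝ, E') f x u) - mfderiv 𝓘(ℝ, E) 𝓘(ℝ, E') f x a)
      (mfderiv 𝓘(ℝ, E) 𝓘(ℝ, E') f x w) = 0

/-- `(u₁, u₂)` is a pseudo-orthonormal pair of tangent vectors of `M` at `x`:
`⟨u₁,u₁⟩ = ⟨u₂,u₂⟩ = 0`, `⟨u₁,u₂⟩ = -1`. -/
def IsPseudoOrthonormal (g : BilinField E M) (x : M) (u₁ u₂ : TangentSpace 𝓘(ℝ, E) x) : Prop :=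
  g x u₁ u₁ = 0 ∧ g x u₂ u₂ = 0 ∧ g x u₁ u₂ = -1

/-- The surface `f : M → N` is slant with slant angle `θ`: its Wirtinger angle is the constant
`θ`, that is, every tangent plane has a pseudo-orthonormal basis `(e₁, e₂)` with
`P e₁ = (sinh θ) e₁` and `P e₂ = -(sinh θ) e₂`. (Exchanging `e₁` and `e₂` changes the sign of
the angle, so the basis has to be chosen suitably at each point.) -/
def IsSlant (g : BilinField E' N) (J : EndoField E' N) (f : M → N) (θ : ℝ) : Prop :=
  ∀ x : M, ∃ e₁ e₂ : TangentSpace 𝓘(ℝ, E) x,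
    IsPseudoOrthonormal (inducedMetric (E := E) g f) x e₁ e₂ ∧
    IsTangentialPart g J f x e₁ (Real.sinh θ • e₁) ∧
    IsTangentialPart g J f x e₂ (-Real.sinh θ • e₂)

/-- `f` is Lagrangian (for a half-dimensional `M`): `J` maps each tangent space of `M` into the
normal space. -/
def IsLagrangian (g : BilinField E' N) (J : EndoField E' N) (f : M → N) : Prop :=
  ∀ (x : M) (u w : TangentSpace 𝓘(ℝ, E) x),
    g (f x) (J (f x) (mfderiv 𝓘(ℝ, E) 𝓘(ℝ, E') f x u)) (mfderiv 𝓘(ℝ, E) 𝓘(ℝ, E') f x w) = 0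

end Manifold

end LorentzSurface

end

set_option maxSynthPendingDepth 3

/-! Put `s = sinh θ` and suppose `s ≠ 0`. Write `h` for the second fundamental form and `e₁, e₂` for
a slant null basis at one point. The slant condition says that the Kähler form of the surface is, up
to sign, `s` times the area form. The area form is parallel and so is `J`, so differentiating this
relation makes `⟨h(u, v), J w⟩` totally symmetric (`cubicForm_symm`; this is where `s ≠ 0` enters).
Minimality means `h(e₁, e₂) = 0`, hence `⟨h(e₂, e₂), J e₁⟩ = 0`. A vector orthogonal to `e₁`, `e₂`
and `J e₁` is a multiple of `J e₁ - s e₁` (`exists_eq_smul_of_orthogonal`). Applying `J` gives the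
algebraic relation `⟨h(e₁, e₁), J h(e₂, e₂)⟩ = -s ⟨h(e₁, e₁), h(e₂, e₂)⟩`. On the other hand, the
Gauss-Codazzi equation (`gauss_codazzi`) for the flat metric, with the prescribed ambient curvature,
determines both products. Pairing it with `e₂` gives `⟨h(e₁, e₁), h(e₂, e₂)⟩ = c (1 - 3 s²)`;
pairing it with `J e₂` gives `⟨h(e₁, e₁), J h(e₂, e₂)⟩ = -4 c s`. The three relations force `3 c s
(1 + s²) = 0`, which is impossible, so `s = 0` (`slant_eq_zero`). Then `P = 0`, which is the
Lagrangian condition. Conversely, on a Lagrangian surface `P = 0`, so any null basis witnesses slant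
angle `0`; one exists because the plane is Lorentzian (`exists_null_basis`). Slant bases are only
given pointwise, with no smoothness. Everything to be differentiated is therefore stated as a
polynomial identity in fixed vectors (`sq_eq_of_null`, `trace_free_polynomial`). -/

noncomputable section

namespace LorentzSurface

/-! ### The Levi-Civita connection in coordinates. -/

section Christoffel

variable {E : Type*} [NormedAddCommGroup E] [NormedSpace ℝ E]

/-- The Levi-Civita connection on constant vector fields, as a continuous bilinear map. -/
def christoffelCLM (G : E → E →L[ℝ] E →L[ℝ] ℝ) (y : E) : E →L[ℝ] E →L[ℝ] E :=
  (ContinuousLinearMap.compL ℝ E (E →L[ℝ] ℝ) E (G y).inverse).comp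
    ((2⁻¹ : ℝ) • (fderiv ℝ G y + (fderiv ℝ G y).flip
      - (ContinuousLinearMap.flipₗᵢ ℝ E E ℝ).toContinuousLinearEquiv.toContinuousLinearMap.comp
          (fderiv ℝ G y).flip))

theorem christoffelCLM_apply (G : E → E →L[ℝ] E →L[ℝ] ℝ) (y u v : E) :
    christoffelCLM G y u v = christoffel G y u v := rfl

/-- A nondegenerate bilinear form on a finite dimensional space is invertible as a map to the
dual. -/
theorem isInvertible_of_nondegenerate [FiniteDimensional ℝ E] {B : E →L[ℝ] E →L[ℝ] ℝ}
    (hB : ∀ u, (∀ v, B u v = 0) → u = 0) : B.IsInvertible := by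
  have hinj : Function.Injective (B : E →ₗ[ℝ] (E →L[ℝ] ℝ)) := by
    rw [← LinearMap.ker_eq_bot, LinearMap.ker_eq_bot']
    intro u hu
    refine hB u fun v => ?_
    have : B u = 0 := hu
    simp [this]
  have hdim : Module.finrank ℝ E = Module.finrank ℝ (E →L[ℝ] ℝ) := by
    rw [← (LinearMap.toContinuousLinearMap (𝕜 := ℝ) (E := E) (F' := ℝ)).finrank_eq]
    exact (Subspace.dual_finrank_eq (K := ℝ) (V := E)).symm
  refine ⟨(LinearEquiv.ofInjectiveOfFinrankEq (B : E →ₗ[ℝ] (E →L[ℝ] ℝ)) hinj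
    hdim).toContinuousLinearEquiv, ?_⟩
  ext u v
  rfl

/-- The Koszul formula with the index lowered. Nondegeneracy is essential: `inverse` takes the
default value `0` on a non-invertible map. -/
theorem apply_christoffel [FiniteDimensional ℝ E] {G : E → E →L[ℝ] E →L[ℝ] ℝ} {y : E}
    (hnd : ∀ u, (∀ v, G y u v = 0) → u = 0) (u v w : E) :
    2 * G y (christoffel G y u v) w
      = fderiv ℝ G y u v w + fderiv ℝ G y v u w - fderiv ℝ G y w u v := by
  have h := isInvertible_of_nondegenerate hnd
  rw [christoffel, h.self_apply_inverse]
  simp [ContinuousLinearMap.flip_apply]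

theorem fderiv_apply_apply_symm {G : E → E →L[ℝ] E →L[ℝ] ℝ} {y : E}
    (hG : DifferentiableAt ℝ G y) (hsymm : ∀ᶠ z in nhds y, ∀ u v, G z u v = G z v u)
    (x u v : E) : fderiv ℝ G y x u v = fderiv ℝ G y x v u := by
  have key : ∀ u v, HasFDerivAt (fun z => G z u v)
      ((ContinuousLinearMap.apply ℝ ℝ v).comp
        ((ContinuousLinearMap.apply ℝ (E →L[ℝ] ℝ) u).comp (fderiv ℝ G y))) y := fun u v =>
    (ContinuousLinearMap.apply ℝ ℝ v).hasFDerivAt.comp y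
      ((ContinuousLinearMap.apply ℝ (E →L[ℝ] ℝ) u).hasFDerivAt.comp y hG.hasFDerivAt)
  have h1 := (key u v).congr_of_eventuallyEq (f₁ := fun z => G z v u)
    (hsymm.mono fun z hz => (hz u v).symm)
  simpa using DFunLike.congr_fun (h1.unique (key v u)) x

theorem christoffel_symm {G : E → E →L[ℝ] E →L[ℝ] ℝ} {y : E}
    (hG : DifferentiableAt ℝ G y) (hsymm : ∀ᶠ z in nhds y, ∀ u v, G z u v = G z v u)
    (u v : E) : christoffel G y u v = christoffel G y v u := by
  unfold christoffel
  congr 2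
  ext w
  simp [ContinuousLinearMap.flip_apply, fderiv_apply_apply_symm hG hsymm w u v, add_comm]

/-- The Levi-Civita connection is metric. -/
theorem fderiv_metric [FiniteDimensional ℝ E] {G : E → E →L[ℝ] E →L[ℝ] ℝ} {y : E}
    (hnd : ∀ u, (∀ v, G y u v = 0) → u = 0)
    (hG : DifferentiableAt ℝ G y) (hsymm : ∀ᶠ z in nhds y, ∀ u v, G z u v = G z v u)
    (x u v : E) : fderiv ℝ G y x u v
      = G y (christoffel G y x u) v + G y u (christoffel G y x v) := by
  have h1 := apply_christoffel hnd x u v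
  have h2 := apply_christoffel hnd x v u
  have h3 := fderiv_apply_apply_symm hG hsymm x u v
  have h4 := fderiv_apply_apply_symm hG hsymm v x u
  have h5 := fderiv_apply_apply_symm hG hsymm u v x
  have h6 := hsymm.self_of_nhds u (christoffel G y x v)
  linarith

theorem contDiffAt_christoffelCLM [FiniteDimensional ℝ E] {G : E → E →L[ℝ] E →L[ℝ] ℝ} {y : E}
    (hnd : ∀ u, (∀ v, G y u v = 0) → u = 0) (hG : ContDiffAt ℝ ∞ G y) :
    ContDiffAt ℝ ∞ (christoffelCLM G) y := by
  have h := isInvertible_of_nondegenerate hnd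
  have hd : ContDiffAt ℝ ∞ (fderiv ℝ G) y := hG.fderiv_right (m := ∞) le_rfl
  have hinv : ContDiffAt ℝ ∞ (fun z => (G z).inverse) y :=
    ContDiffAt.comp y h.contDiffAt_map_inverse hG
  have hfl : ContDiffAt ℝ ∞ (fun z => (fderiv ℝ G z).flip) y :=
    (ContinuousLinearMap.flipₗᵢ ℝ E E (E →L[ℝ] ℝ)).contDiff.contDiffAt.comp y hd
  unfold christoffelCLM
  refine ContDiffAt.clm_comp ?_ ?_
  · exact (ContinuousLinearMap.compL ℝ E (E →L[ℝ] ℝ) E).contDiff.contDiffAt.comp y hinv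
  · refine ((hd.add hfl).sub (contDiffAt_const.clm_comp hfl)).const_smul _

end Christoffel

/-! ### Covariant differentiation along a map, and its commutator. -/

section CovariantDerivative

variable {E : Type*} [NormedAddCommGroup E] [NormedSpace ℝ E]
  {E' : Type*} [NormedAddCommGroup E'] [NormedSpace ℝ E']

/-- The covariant derivative at `y` in the direction `x` of a vector field `W` along `F`. -/
def covDerivAlong (G' : E' → E' →L[ℝ] E' →L[ℝ] ℝ) (F W : E → E') (y x : E) : E' :=
  fderiv ℝ W y x + christoffel G' (F y) (fderiv ℝ F y x) (W y)

variable {G' : E' → E' →L[ℝ] E' →L[ℝ] ℝ} {F W : E → E'} {y : E}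

theorem covDerivAlong_sub {W₁ W₂ : E → E'} (h₁ : DifferentiableAt ℝ W₁ y)
    (h₂ : DifferentiableAt ℝ W₂ y) (x : E) :
    covDerivAlong G' F (fun z => W₁ z - W₂ z) y x
      = covDerivAlong G' F W₁ y x - covDerivAlong G' F W₂ y x := by
  simp only [covDerivAlong, ← christoffelCLM_apply]
  rw [fderiv_fun_sub h₁ h₂]
  simp only [sub_apply, map_sub]
  abel

/-- Leibniz rule for the metric along `F`. -/
theorem fderiv_metric_along [FiniteDimensional ℝ E']
    (hnd : ∀ u, (∀ v, G' (F y) u v = 0) → u = 0) (hG : DifferentiableAt ℝ G' (F y))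
    (hsymm : ∀ᶠ z in nhds (F y), ∀ u v, G' z u v = G' z v u)
    (hF : DifferentiableAt ℝ F y) {W₁ W₂ : E → E'} (h₁ : DifferentiableAt ℝ W₁ y)
    (h₂ : DifferentiableAt ℝ W₂ y) (x : E) :
    fderiv ℝ (fun z => G' (F z) (W₁ z) (W₂ z)) y x
      = G' (F y) (covDerivAlong G' F W₁ y x) (W₂ y)
        + G' (F y) (W₁ y) (covDerivAlong G' F W₂ y x) := by
  have h := ((hG.hasFDerivAt.comp y hF.hasFDerivAt).clm_apply h₁.hasFDerivAt).clm_apply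
    h₂.hasFDerivAt
  have h' := h.fderiv
  simp only [Function.comp_def] at h'
  rw [h']
  have hm := fderiv_metric hnd hG hsymm (fderiv ℝ F y x) (W₁ y) (W₂ y)
  simp only [covDerivAlong, map_add, add_apply,
    ContinuousLinearMap.comp_apply, ContinuousLinearMap.flip_apply, hm]
  ring

/-- A parallel field of endomorphisms commutes with covariant differentiation along `F`. -/
theorem covDerivAlong_endo {J : E' → E' →L[ℝ] E'} (hJ : DifferentiableAt ℝ J (F y))
    (hpar : ∀ u v, covDerivEndo G' J (F y) u v = 0)
    (hF : DifferentiableAt ℝ F y) (hW : DifferentiableAt ℝ W y) (x : E) :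
    covDerivAlong G' F (fun z => J (F z) (W z)) y x = J (F y) (covDerivAlong G' F W y x) := by
  have h' := ((hJ.hasFDerivAt.comp y hF.hasFDerivAt).clm_apply hW.hasFDerivAt).fderiv
  simp only [Function.comp_def] at h'
  have hm := hpar (fderiv ℝ F y x) (W y)
  simp only [covDerivEndo] at hm
  rw [sub_eq_zero] at hm
  simp only [covDerivAlong, h', map_add, add_apply,
    ContinuousLinearMap.comp_apply, ContinuousLinearMap.flip_apply]
  rw [← hm]
  abel

theorem two_le_infty : (2 : WithTop ℕ∞) ≤ ∞ := by
  exact WithTop.coe_le_coe.2 (le_top : (2 : ℕ∞) ≤ ⊤)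

theorem fderiv_fderiv_apply (hF : ContDiffAt ℝ 2 F y) (x v : E) :
    fderiv ℝ (fun z => fderiv ℝ F z v) y x = fderiv ℝ (fderiv ℝ F) y x v := by
  have h : DifferentiableAt ℝ (fderiv ℝ F) y :=
    (hF.fderiv_right (m := 1) (by norm_num)).differentiableAt (by simp)
  rw [fderiv_clm_apply h (differentiableAt_const v)]
  simp

theorem fderiv_fderiv_symm (hF : ContDiffAt ℝ ∞ F y) (x v : E) :
    fderiv ℝ (fderiv ℝ F) y x v = fderiv ℝ (fderiv ℝ F) y v x :=
  (hF.isSymmSndFDerivAt (by simpa using two_le_infty)) x v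

/-- The commutator of covariant derivatives of `∂_v F` is the curvature of the target. -/
theorem covDerivAlong_commutator [FiniteDimensional ℝ E']
    (hnd : ∀ u, (∀ v, G' (F y) u v = 0) → u = 0) (hG : ContDiffAt ℝ ∞ G' (F y))
    (hF : ContDiffAt ℝ ∞ F y) (x u v : E) :
    covDerivAlong G' F (fun z => covDerivAlong G' F (fun z => fderiv ℝ F z v) z u) y x
      - covDerivAlong G' F (fun z => covDerivAlong G' F (fun z => fderiv ℝ F z v) z x) y u
      = curvature G' (F y) (fderiv ℝ F y x) (fderiv ℝ F y u) (fderiv ℝ F y v) := by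
  have hΓ : DifferentiableAt ℝ (christoffelCLM G') (F y) :=
    (contDiffAt_christoffelCLM hnd hG).differentiableAt (by simp)
  have hF1 : ContDiffAt ℝ ∞ (fderiv ℝ F) y := hF.fderiv_right (m := ∞) le_rfl
  have hF2 : ContDiffAt ℝ ∞ (fderiv ℝ (fderiv ℝ F)) y := hF1.fderiv_right (m := ∞) le_rfl
  have hd0 : DifferentiableAt ℝ F y := hF.differentiableAt (by simp)
  have hd1 : DifferentiableAt ℝ (fderiv ℝ F) y := hF1.differentiableAt (by simp)
  have hd2 : DifferentiableAt ℝ (fderiv ℝ (fderiv ℝ F)) y := hF2.differentiableAt (by simp)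
  have hev : ∀ u, (fun z => covDerivAlong G' F (fun z => fderiv ℝ F z v) z u) =ᶠ[nhds y]
      fun z => fderiv ℝ (fderiv ℝ F) z u v
        + christoffelCLM G' (F z) (fderiv ℝ F z u) (fderiv ℝ F z v) := by
    intro u
    have : ∀ᶠ z in nhds y, ContDiffAt ℝ 2 F z :=
      (hF.of_le two_le_infty).eventually (by simp)
    filter_upwards [this] with z hz
    rw [covDerivAlong, fderiv_fderiv_apply hz, christoffelCLM_apply]
  have hder : ∀ x u, fderiv ℝ (fun z => covDerivAlong G' F (fun z => fderiv ℝ F z v) z u) y x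
      = fderiv ℝ (fderiv ℝ (fderiv ℝ F)) y x u v
        + (fderiv ℝ (christoffelCLM G') (F y) (fderiv ℝ F y x) (fderiv ℝ F y u) (fderiv ℝ F y v)
        + christoffelCLM G' (F y) (fderiv ℝ (fderiv ℝ F) y x u) (fderiv ℝ F y v)
        + christoffelCLM G' (F y) (fderiv ℝ F y u) (fderiv ℝ (fderiv ℝ F) y x v)) := by
    intro x u
    rw [(hev u).fderiv_eq]
    have h1 := (hd2.hasFDerivAt.clm_apply (hasFDerivAt_const u y)).clm_apply
      (hasFDerivAt_const v y)
    have hu := hd1.hasFDerivAt.clm_apply (hasFDerivAt_const u y)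
    have hv := hd1.hasFDerivAt.clm_apply (hasFDerivAt_const v y)
    have h2 := ((hΓ.hasFDerivAt.comp y hd0.hasFDerivAt).clm_apply hu).clm_apply hv
    have h3 := (h1.add h2).fderiv
    simp only [Function.comp_def, Pi.add_def] at h3
    rw [h3]
    simp
    abel
  have hcurv : ∀ a b d, fderiv ℝ (fun z => christoffel G' z b d) (F y) a
      = fderiv ℝ (christoffelCLM G') (F y) a b d := by
    intro a b d
    have h1 := (hΓ.hasFDerivAt.clm_apply (hasFDerivAt_const b (F y))).clm_apply
      (hasFDerivAt_const d (F y))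
    have h2 := h1.fderiv
    simp only [christoffelCLM_apply] at h2
    rw [h2]
    simp
  have hval : ∀ u, covDerivAlong G' F (fun z => fderiv ℝ F z v) y u
      = fderiv ℝ (fderiv ℝ F) y u v
        + christoffelCLM G' (F y) (fderiv ℝ F y u) (fderiv ℝ F y v) := fun u =>
    (hev u).self_of_nhds
  simp only [covDerivAlong] at hder hval ⊢
  -- Second and third derivatives of `F` are symmetric in `x` and `u`, so they cancel in the
  -- commutator, leaving the derivatives of the Christoffel symbols and their quadratic terms.
  rw [hder, hder, hval, hval, curvature, hcurv, hcurv,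
    fderiv_fderiv_symm hF1 x u, fderiv_fderiv_symm hF x u]
  simp only [← christoffelCLM_apply, map_add]
  abel

end CovariantDerivative

/-! ### Submanifold equations in coordinates. -/

section CoordinateImmersion

variable {E : Type*} [NormedAddCommGroup E] [NormedSpace ℝ E]
  {E' : Type*} [NormedAddCommGroup E'] [NormedSpace ℝ E']

/-- `F` is a smooth map from the open set `U` to the open set `V`, where `V` carries the
pseudo-Riemannian metric `G'`, and `G` is the induced metric on `U`, which is nondegenerate. -/
structure IsCoordinateImmersion (U : Set E) (V : Set E') (G : E → E →L[ℝ] E →L[ℝ] ℝ)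
    (G' : E' → E' →L[ℝ] E' →L[ℝ] ℝ) (F : E → E') : Prop where
  isOpen_source : IsOpen U
  isOpen_target : IsOpen V
  mapsTo : ∀ y ∈ U, F y ∈ V
  smooth : ContDiffOn ℝ ∞ F U
  smooth_target : ContDiffOn ℝ ∞ G' V
  symm_target : ∀ y ∈ V, ∀ u v, G' y u v = G' y v u
  nondegenerate_target : ∀ y ∈ V, ∀ u, (∀ v, G' y u v = 0) → u = 0
  induced : ∀ y ∈ U, ∀ u v, G y u v = G' (F y) (fderiv ℝ F y u) (fderiv ℝ F y v)
  nondegenerate : ∀ y ∈ U, ∀ u, (∀ v, G y u v = 0) → u = 0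

/-- The second fundamental form as a continuous bilinear map. -/
def secondFundamentalCLM (G : E → E →L[ℝ] E →L[ℝ] ℝ) (G' : E' → E' →L[ℝ] E' →L[ℝ] ℝ)
    (F : E → E') (y : E) : E →L[ℝ] E →L[ℝ] E' :=
  fderiv ℝ (fderiv ℝ F) y
    + (christoffelCLM G' (F y)).bilinearComp (fderiv ℝ F y) (fderiv ℝ F y)
    - (ContinuousLinearMap.compL ℝ E E E' (fderiv ℝ F y)).comp (christoffelCLM G y)

namespace IsCoordinateImmersion

variable {U : Set E} {V : Set E'} {G : E → E →L[ℝ] E →L[ℝ] ℝ}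
  {G' : E' → E' →L[ℝ] E' →L[ℝ] ℝ} {F : E → E'} (H : IsCoordinateImmersion U V G G' F)
  {y : E} (hy : y ∈ U)

include H hy

theorem mem_nhds : U ∈ nhds y := H.isOpen_source.mem_nhds hy

theorem mem_nhds_target : V ∈ nhds (F y) := H.isOpen_target.mem_nhds (H.mapsTo y hy)

theorem contDiffAt : ContDiffAt ℝ ∞ F y := H.smooth.contDiffAt (H.mem_nhds hy)

theorem contDiffAt_fderiv : ContDiffAt ℝ ∞ (fderiv ℝ F) y :=
  (H.contDiffAt hy).fderiv_right (m := ∞) le_rfl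

theorem differentiableAt : DifferentiableAt ℝ F y := (H.contDiffAt hy).differentiableAt (by simp)

theorem differentiableAt_fderiv (v : E) : DifferentiableAt ℝ (fun z => fderiv ℝ F z v) y :=
  ((H.contDiffAt_fderiv hy).differentiableAt (by simp)).clm_apply (differentiableAt_const v)

theorem contDiffAt_target : ContDiffAt ℝ ∞ G' (F y) :=
  H.smooth_target.contDiffAt (H.mem_nhds_target hy)

theorem eventually_symm_target : ∀ᶠ z in nhds (F y), ∀ u v, G' z u v = G' z v u := by
  filter_upwards [H.mem_nhds_target hy] with z hz using H.symm_target z hz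

theorem symm (u v : E) : G y u v = G y v u := by
  rw [H.induced y hy, H.induced y hy, H.symm_target _ (H.mapsTo y hy)]

theorem eventually_symm : ∀ᶠ z in nhds y, ∀ u v, G z u v = G z v u := by
  filter_upwards [H.mem_nhds hy] with z hz using H.symm hz

/-- On `U` the metric is determined by its entries, which are smooth expressions in `F`, its
differential and `G'`; in finite dimension entrywise smoothness suffices. -/
theorem contDiffAt_metric [FiniteDimensional ℝ E] : ContDiffAt ℝ ∞ G y := by
  refine ContDiffOn.contDiffAt (contDiffOn_clm_apply.2 fun u => contDiffOn_clm_apply.2 fun v => ?_)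
    (H.mem_nhds hy)
  refine ContDiffOn.congr ?_ fun z hz => H.induced z hz u v
  have h1 : ContDiffOn ℝ ∞ (fderiv ℝ F) U := fun z hz =>
    (H.contDiffAt_fderiv hz).contDiffWithinAt
  exact ((H.smooth_target.comp H.smooth H.mapsTo).clm_apply
    (h1.clm_apply contDiffOn_const)).clm_apply (h1.clm_apply contDiffOn_const)

theorem differentiableAt_metric [FiniteDimensional ℝ E] (u v : E) :
    DifferentiableAt ℝ (fun z => G z u v) y :=
  (((H.contDiffAt_metric hy).differentiableAt (by simp)).clm_apply
    (differentiableAt_const u)).clm_apply (differentiableAt_const v)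

theorem christoffel_comm [FiniteDimensional ℝ E] (u v : E) :
    christoffel G y u v = christoffel G y v u :=
  christoffel_symm ((H.contDiffAt_metric hy).differentiableAt (by simp)) (H.eventually_symm hy) u v

theorem fderiv_metric_apply [FiniteDimensional ℝ E] (x u v : E) :
    fderiv ℝ (fun z => G z u v) y x
      = G y (christoffel G y x u) v + G y u (christoffel G y x v) := by
  have hd := (H.contDiffAt_metric hy).differentiableAt (by simp)
  have h := ((hd.hasFDerivAt.clm_apply (hasFDerivAt_const u y)).clm_apply
    (hasFDerivAt_const v y)).fderiv
  rw [h, ← fderiv_metric (H.nondegenerate y hy) hd (H.eventually_symm hy) x u v]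
  simp

theorem fderiv_target_apply [FiniteDimensional ℝ E'] {W₁ W₂ : E → E'}
    (h₁ : DifferentiableAt ℝ W₁ y) (h₂ : DifferentiableAt ℝ W₂ y) (x : E) :
    fderiv ℝ (fun z => G' (F z) (W₁ z) (W₂ z)) y x
      = G' (F y) (covDerivAlong G' F W₁ y x) (W₂ y)
        + G' (F y) (W₁ y) (covDerivAlong G' F W₂ y x) :=
  fderiv_metric_along (H.nondegenerate_target _ (H.mapsTo y hy))
    ((H.contDiffAt_target hy).differentiableAt (by simp)) (H.eventually_symm_target hy)
    (H.differentiableAt hy) h₁ h₂ x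

theorem secondFundamentalCLM_apply (u v : E) :
    secondFundamentalCLM G G' F y u v = secondFundamentalForm G G' F y u v := by
  rw [secondFundamentalForm,
    fderiv_fderiv_apply ((H.contDiffAt hy).of_le two_le_infty)]
  rfl

theorem secondFundamentalCLM_symm [FiniteDimensional ℝ E] [FiniteDimensional ℝ E'] (u v : E) :
    secondFundamentalCLM G G' F y u v = secondFundamentalCLM G G' F y v u := by
  have h1 : christoffel G' (F y) (fderiv ℝ F y u) (fderiv ℝ F y v)
      = christoffel G' (F y) (fderiv ℝ F y v) (fderiv ℝ F y u) :=
    christoffel_symm ((H.contDiffAt_target hy).differentiableAt (by simp))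
      (H.eventually_symm_target hy) _ _
  simp only [secondFundamentalCLM, sub_apply, add_apply, ContinuousLinearMap.bilinearComp_apply,
    ContinuousLinearMap.comp_apply, ContinuousLinearMap.compL_apply, christoffelCLM_apply, h1,
    H.christoffel_comm hy u v, fderiv_fderiv_symm (H.contDiffAt hy) u v]

/-- Formula of Gauss. -/
theorem covDerivAlong_fderiv (x v : E) :
    covDerivAlong G' F (fun z => fderiv ℝ F z v) y x
      = fderiv ℝ F y (christoffel G y x v) + secondFundamentalCLM G G' F y x v := by
  rw [H.secondFundamentalCLM_apply hy, covDerivAlong, secondFundamentalForm]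
  abel

theorem covDerivAlong_fderiv_apply {w : E → E} (hw : DifferentiableAt ℝ w y) (x : E) :
    covDerivAlong G' F (fun z => fderiv ℝ F z (w z)) y x
      = fderiv ℝ F y (fderiv ℝ w y x + christoffel G y x (w y))
        + secondFundamentalCLM G G' F y x (w y) := by
  have hd : DifferentiableAt ℝ (fderiv ℝ F) y :=
    (H.contDiffAt_fderiv hy).differentiableAt (by simp)
  rw [map_add, add_assoc, ← H.covDerivAlong_fderiv hy, covDerivAlong, covDerivAlong,
    fderiv_clm_apply hd hw, fderiv_fderiv_apply ((H.contDiffAt hy).of_le two_le_infty)]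
  simp [add_assoc]

/-- Both connections are metric, so `⟨h(x, u), dF v⟩` is skew in `u, v`; it is symmetric in `x, u`.
A trilinear form symmetric in the first two slots and skew in the last two vanishes. -/
theorem inner_secondFundamental_fderiv [FiniteDimensional ℝ E] [FiniteDimensional ℝ E']
    (u v w : E) :
    G' (F y) (secondFundamentalCLM G G' F y u v) (fderiv ℝ F y w) = 0 := by
  set B := secondFundamentalCLM G G' F y with hB
  have hs := H.symm_target _ (H.mapsTo y hy)
  have key : ∀ x u v, G' (F y) (B x u) (fderiv ℝ F y v)
      + G' (F y) (B x v) (fderiv ℝ F y u) = 0 := by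
    intro x u v
    have h1 := H.fderiv_metric_apply hy x u v
    have h : (fun z => G z u v) =ᶠ[nhds y]
        fun z => G' (F z) (fderiv ℝ F z u) (fderiv ℝ F z v) := by
      filter_upwards [H.mem_nhds hy] with z hz using H.induced z hz u v
    rw [h.fderiv_eq, H.fderiv_target_apply hy (H.differentiableAt_fderiv hy u)
      (H.differentiableAt_fderiv hy v), H.covDerivAlong_fderiv hy, H.covDerivAlong_fderiv hy,
      H.induced y hy, H.induced y hy, ← hB] at h1
    simp only [map_add, add_apply] at h1
    have h2 := hs (B x v) (fderiv ℝ F y u)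
    linarith
  have hsymm : ∀ u v, B u v = B v u := H.secondFundamentalCLM_symm hy
  have h1 := key u v w
  have h2 := key v w u
  have h3 := key w u v
  rw [hsymm w u] at h3
  rw [hsymm v u] at h2
  rw [hsymm w v] at h3
  linarith

theorem contDiffAt_christoffel [FiniteDimensional ℝ E] (u v : E) :
    ContDiffAt ℝ ∞ (fun z => christoffel G z u v) y :=
  ((contDiffAt_christoffelCLM (H.nondegenerate y hy) (H.contDiffAt_metric hy)).clm_apply
    contDiffAt_const).clm_apply contDiffAt_const

theorem differentiableAt_christoffel [FiniteDimensional ℝ E] (u v : E) :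
    DifferentiableAt ℝ (fun z => christoffel G z u v) y :=
  (H.contDiffAt_christoffel hy u v).differentiableAt (by simp)

theorem differentiableAt_covDerivAlong [FiniteDimensional ℝ E] [FiniteDimensional ℝ E'] (u v : E) :
    DifferentiableAt ℝ (fun z => covDerivAlong G' F (fun z => fderiv ℝ F z v) z u) y := by
  have hev : (fun z => covDerivAlong G' F (fun z => fderiv ℝ F z v) z u) =ᶠ[nhds y]
      fun z => fderiv ℝ (fderiv ℝ F) z u v
        + christoffelCLM G' (F z) (fderiv ℝ F z u) (fderiv ℝ F z v) := by
    filter_upwards [H.mem_nhds hy] with z hz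
    rw [covDerivAlong, fderiv_fderiv_apply ((H.contDiffAt hz).of_le two_le_infty),
      christoffelCLM_apply]
  have hΓ : DifferentiableAt ℝ (christoffelCLM G') (F y) :=
    (contDiffAt_christoffelCLM (H.nondegenerate_target _ (H.mapsTo y hy))
      (H.contDiffAt_target hy)).differentiableAt (by simp)
  have hd2 : DifferentiableAt ℝ (fderiv ℝ (fderiv ℝ F)) y :=
    ((H.contDiffAt_fderiv hy).fderiv_right (m := ∞) le_rfl).differentiableAt (by simp)
  refine DifferentiableAt.congr_of_eventuallyEq ?_ hev
  exact ((hd2.clm_apply (differentiableAt_const u)).clm_apply (differentiableAt_const v)).add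
    (((hΓ.comp y (H.differentiableAt hy)).clm_apply
      (H.differentiableAt_fderiv hy u)).clm_apply (H.differentiableAt_fderiv hy v))

theorem eventually_secondFundamental (u v : E) :
    (fun z => secondFundamentalCLM G G' F z u v) =ᶠ[nhds y]
      fun z => covDerivAlong G' F (fun z => fderiv ℝ F z v) z u
        - fderiv ℝ F z (christoffel G z u v) := by
  filter_upwards [H.mem_nhds hy] with z hz
  rw [H.covDerivAlong_fderiv hz]
  abel

theorem differentiableAt_fderiv_christoffel [FiniteDimensional ℝ E] (u v : E) :
    DifferentiableAt ℝ (fun z => fderiv ℝ F z (christoffel G z u v)) y :=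
  ((H.contDiffAt_fderiv hy).differentiableAt (by simp)).clm_apply
    (H.differentiableAt_christoffel hy u v)

theorem differentiableAt_secondFundamental [FiniteDimensional ℝ E] [FiniteDimensional ℝ E']
    (u v : E) : DifferentiableAt ℝ (fun z => secondFundamentalCLM G G' F z u v) y :=
  ((H.differentiableAt_covDerivAlong hy u v).sub
    (H.differentiableAt_fderiv_christoffel hy u v)).congr_of_eventuallyEq
    (H.eventually_secondFundamental hy u v)

/-- The equations of Gauss and Codazzi. -/
theorem gauss_codazzi [FiniteDimensional ℝ E] [FiniteDimensional ℝ E'] (x u v : E) :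
    covDerivAlong G' F (fun z => secondFundamentalCLM G G' F z u v) y x
      - covDerivAlong G' F (fun z => secondFundamentalCLM G G' F z x v) y u
      + secondFundamentalCLM G G' F y x (christoffel G y u v)
      - secondFundamentalCLM G G' F y u (christoffel G y x v)
      = curvature G' (F y) (fderiv ℝ F y x) (fderiv ℝ F y u) (fderiv ℝ F y v)
        - fderiv ℝ F y (curvature G y x u v) := by
  -- Differentiate `h(u, v) = ∇_u dF(v) - dF(Γ(u, v))`. The field `Γ(u, v)` is not constant, so the
  -- formula of Gauss is needed for variable fields.
  have hA : ∀ x u, covDerivAlong G' F (fun z => secondFundamentalCLM G G' F z u v) y x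
      = covDerivAlong G' F (fun z => covDerivAlong G' F (fun z => fderiv ℝ F z v) z u) y x
        - (fderiv ℝ F y (fderiv ℝ (fun z => christoffel G z u v) y x
            + christoffel G y x (christoffel G y u v))
          + secondFundamentalCLM G G' F y x (christoffel G y u v)) := by
    intro x u
    have hev := H.eventually_secondFundamental hy u v
    rw [← H.covDerivAlong_fderiv_apply hy (H.differentiableAt_christoffel hy u v),
      ← covDerivAlong_sub (H.differentiableAt_covDerivAlong hy u v)
        (H.differentiableAt_fderiv_christoffel hy u v), covDerivAlong, covDerivAlong,
      hev.fderiv_eq]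
    exact congrArg _ (congrArg _ hev.self_of_nhds)
  rw [hA, hA, ← covDerivAlong_commutator (H.nondegenerate_target _ (H.mapsTo y hy))
    (H.contDiffAt_target hy) (H.contDiffAt hy), curvature]
  simp only [map_add, map_sub]
  abel

end IsCoordinateImmersion

end CoordinateImmersion

/-! ### Linear algebra of null bases. -/

section NullBasis

variable {E : Type*} [NormedAddCommGroup E] [NormedSpace ℝ E]

/-- Expansion of a vector in a null basis of a Lorentzian plane. -/
theorem eq_smul_add_smul_of_null (hE : Module.finrank ℝ E = 2) {B : E →L[ℝ] E →L[ℝ] ℝ}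
    (hsymm : ∀ u v, B u v = B v u) {e₁ e₂ : E} (h₁ : B e₁ e₁ = 0) (h₂ : B e₂ e₂ = 0)
    (h₁₂ : B e₁ e₂ = -1) (u : E) : u = (-B u e₂) • e₁ + (-B u e₁) • e₂ := by
  have : FiniteDimensional ℝ E := Module.finite_of_finrank_pos (by omega)
  have h₂₁ : B e₂ e₁ = -1 := by rw [hsymm, h₁₂]
  have hli : LinearIndependent ℝ ![e₁, e₂] := by
    rw [LinearIndependent.pair_iff]
    intro a b hab
    have h1 := congrArg (fun w => B w e₁) hab
    have h2 := congrArg (fun w => B w e₂) hab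
    simp [h₁, h₂₁] at h1
    simp [h₂, h₁₂] at h2
    exact ⟨h2, h1⟩
  have hspan := hli.span_eq_top_of_card_eq_finrank (by simp [hE])
  have hu : u ∈ Submodule.span ℝ (Set.range ![e₁, e₂]) := hspan ▸ Submodule.mem_top
  simp only [Matrix.range_cons, Matrix.range_empty, Set.union_empty, Set.singleton_union] at hu
  obtain ⟨a, b, rfl⟩ := Submodule.mem_span_pair.1 hu
  simp [h₁, h₂, h₁₂, h₂₁]

theorem inverse_apply_of_null (hE : Module.finrank ℝ E = 2) {B : E →L[ℝ] E →L[ℝ] ℝ}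
    (hnd : ∀ u, (∀ v, B u v = 0) → u = 0)
    (hsymm : ∀ u v, B u v = B v u) {e₁ e₂ : E} (h₁ : B e₁ e₁ = 0) (h₂ : B e₂ e₂ = 0)
    (h₁₂ : B e₁ e₂ = -1) (φ : E →L[ℝ] ℝ) : B.inverse φ = (-φ e₂) • e₁ + (-φ e₁) • e₂ := by
  have : FiniteDimensional ℝ E := Module.finite_of_finrank_pos (by omega)
  have h := (isInvertible_of_nondegenerate hnd).self_apply_inverse φ
  have e := eq_smul_add_smul_of_null hE hsymm h₁ h₂ h₁₂ (B.inverse φ)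
  rwa [h] at e

/-- Raising an index in a null basis exchanges the two vectors up to sign, so the trace sees only
the mixed values of `h`. Symmetry of `h` is not needed. -/
theorem metricTrace_of_null [FiniteDimensional ℝ E] (hE : Module.finrank ℝ E = 2)
    {F : Type*} [NormedAddCommGroup F] [NormedSpace ℝ F] {B : E →L[ℝ] E →L[ℝ] ℝ}
    (hnd : ∀ u, (∀ v, B u v = 0) → u = 0)
    (hsymm : ∀ u v, B u v = B v u) {e₁ e₂ : E} (h₁ : B e₁ e₁ = 0) (h₂ : B e₂ e₂ = 0)
    (h₁₂ : B e₁ e₂ = -1) (h : E →L[ℝ] E →L[ℝ] F) :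
    metricTrace B (fun u v => h u v) = -(h e₂ e₁ + h e₁ e₂) := by
  have e : ∀ w : E, w = ∑ i, (Module.finBasis ℝ E).coord i w • Module.finBasis ℝ E i := fun w =>
    ((Module.finBasis ℝ E).sum_repr w).symm
  have s1 : h e₂ e₁ = ∑ i, (Module.finBasis ℝ E).coord i e₂ • h (Module.finBasis ℝ E i) e₁ := by
    conv_lhs => rw [e e₂, map_sum, sum_apply]
    simp only [map_smul, smul_apply]
  have s2 : h e₁ e₂ = ∑ i, (Module.finBasis ℝ E).coord i e₁ • h (Module.finBasis ℝ E i) e₂ := by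
    conv_lhs => rw [e e₁, map_sum, sum_apply]
    simp only [map_smul, smul_apply]
  rw [s1, s2, ← Finset.sum_add_distrib, ← Finset.sum_neg_distrib, metricTrace]
  refine Finset.sum_congr rfl fun i _ => ?_
  rw [inverse_apply_of_null hE hnd hsymm h₁ h₂ h₁₂]
  simp
  abel

/-- A symmetric bilinear map with vanishing trace on a Lorentzian plane. -/
theorem trace_free_polynomial (hE : Module.finrank ℝ E = 2)
    {F : Type*} [NormedAddCommGroup F] [NormedSpace ℝ F] {B : E →L[ℝ] E →L[ℝ] ℝ}
    (hsymm : ∀ u v, B u v = B v u) {e₁ e₂ : E} (h₁ : B e₁ e₁ = 0) (h₂ : B e₂ e₂ = 0)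
    (h₁₂ : B e₁ e₂ = -1) {h : E →L[ℝ] E →L[ℝ] F} (hh : h e₁ e₂ = 0) (hh' : h e₂ e₁ = 0)
    (u v : E) : B v v • h u u - (2 * B u v) • h u v + B u u • h v v = 0 := by
  have h₂₁ : B e₂ e₁ = -1 := by rw [hsymm, h₁₂]
  obtain ⟨a, b, hu⟩ : ∃ a b : ℝ, u = a • e₁ + b • e₂ :=
    ⟨_, _, eq_smul_add_smul_of_null hE hsymm h₁ h₂ h₁₂ u⟩
  obtain ⟨c, d, hv⟩ : ∃ a b : ℝ, v = a • e₁ + b • e₂ :=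
    ⟨_, _, eq_smul_add_smul_of_null hE hsymm h₁ h₂ h₁₂ v⟩
  subst hu hv
  simp only [map_add, map_smul, add_apply, smul_apply, smul_eq_mul, h₁, h₂, h₁₂, h₂₁, hh, hh']
  module

/-- Two-forms on a plane are proportional to the area form, and the bracket is minus the Gram
determinant. Squaring removes the dependence on the orientation of the null basis. -/
theorem sq_eq_of_null (hE : Module.finrank ℝ E = 2) {B Ω : E →L[ℝ] E →L[ℝ] ℝ}
    (hsymm : ∀ u v, B u v = B v u) (hskew : ∀ u v, Ω u v = -Ω v u)
    {e₁ e₂ : E} (h₁ : B e₁ e₁ = 0) (h₂ : B e₂ e₂ = 0)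
    (h₁₂ : B e₁ e₂ = -1) (u v : E) :
    Ω u v ^ 2 = Ω e₁ e₂ ^ 2 * (B u v ^ 2 - B u u * B v v) := by
  have h₂₁ : B e₂ e₁ = -1 := by rw [hsymm, h₁₂]
  have o₁ : Ω e₁ e₁ = 0 := by linarith [hskew e₁ e₁]
  have o₂ : Ω e₂ e₂ = 0 := by linarith [hskew e₂ e₂]
  have o₂₁ := hskew e₂ e₁
  obtain ⟨a, b, hu⟩ : ∃ a b : ℝ, u = a • e₁ + b • e₂ :=
    ⟨_, _, eq_smul_add_smul_of_null hE hsymm h₁ h₂ h₁₂ u⟩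
  obtain ⟨c, d, hv⟩ : ∃ a b : ℝ, v = a • e₁ + b • e₂ :=
    ⟨_, _, eq_smul_add_smul_of_null hE hsymm h₁ h₂ h₁₂ v⟩
  subst hu hv
  simp only [map_add, map_smul, add_apply, smul_apply, smul_eq_mul, h₁, h₂, h₁₂, h₂₁, o₁, o₂, o₂₁]
  ring

/-- A vector orthogonal to `x₁, x₂, J x₁`, where `x₁, x₂` span a slant plane of a complex Lorentzian
plane, is a multiple of the normal part of `J x₁`. -/
theorem exists_eq_smul_of_orthogonal (hE : Module.finrank ℝ E = 4) {g : E →L[ℝ] E →L[ℝ] ℝ}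
    {j : E →L[ℝ] E} (hsymm : ∀ u v, g u v = g v u) (horth : ∀ u v, g (j u) (j v) = g u v)
    {x₁ x₂ : E} {s : ℝ} (h₁ : g x₁ x₁ = 0) (h₂ : g x₂ x₂ = 0) (h₁₂ : g x₁ x₂ = -1)
    (j₁₁ : g (j x₁) x₁ = 0) (j₂₂ : g (j x₂) x₂ = 0) (j₁₂ : g (j x₁) x₂ = -s)
    (j₂₁ : g (j x₂) x₁ = s) {w : E} (w₁ : g w x₁ = 0) (w₂ : g w x₂ = 0)
    (wj : g w (j x₁) = 0) : ∃ b : ℝ, w = b • (j x₁ - s • x₁) := by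
  have : FiniteDimensional ℝ E := Module.finite_of_finrank_pos (by omega)
  have h₂₁ : g x₂ x₁ = -1 := by rw [hsymm, h₁₂]
  have k₁₁ := hsymm x₁ (j x₁)
  have k₁₂ := hsymm x₁ (j x₂)
  have k₂₁ := hsymm x₂ (j x₁)
  have k₂₂ := hsymm x₂ (j x₂)
  have o₁₁ := horth x₁ x₁
  have o₁₂ := horth x₁ x₂
  have o₂₁ := horth x₂ x₁
  have o₂₂ := horth x₂ x₂
  rw [j₁₁] at k₁₁
  rw [j₂₁] at k₁₂
  rw [j₁₂] at k₂₁
  rw [j₂₂] at k₂₂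
  have hs : 0 < 1 + s ^ 2 := by positivity
  have hli : LinearIndependent ℝ ![x₁, x₂, j x₁, j x₂] := by
    rw [Fintype.linearIndependent_iff]
    intro a ha
    simp only [Fin.sum_univ_four, Matrix.cons_val] at ha
    have q₁ := congrArg (fun w => g w x₁) ha
    have q₂ := congrArg (fun w => g w x₂) ha
    have q₃ := congrArg (fun w => g w (j x₁)) ha
    have q₄ := congrArg (fun w => g w (j x₂)) ha
    simp only [map_add, map_smul, add_apply, smul_apply, smul_eq_mul, map_zero, zero_apply,
      h₁, h₂, h₁₂, h₂₁, j₁₁, j₁₂, j₂₁, j₂₂, k₁₁, k₁₂, k₂₁, k₂₂, o₁₁, o₁₂, o₂₁, o₂₂]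
      at q₁ q₂ q₃ q₄
    -- The Gram system decouples into the pairs `(a 1, a 3)` and `(a 0, a 2)`, each with determinant
    -- `1 + s²` up to sign.
    have r₃ : a 3 * (1 + s ^ 2) = 0 := by linear_combination s * q₁ - q₃
    have r₂ : a 2 * (1 + s ^ 2) = 0 := by linear_combination -s * q₂ - q₄
    have z₃ : a 3 = 0 := (mul_eq_zero.1 r₃).resolve_right hs.ne'
    have z₂ : a 2 = 0 := (mul_eq_zero.1 r₂).resolve_right hs.ne'
    have z₁ : a 1 = 0 := by rw [z₃] at q₁; linarith
    have z₀ : a 0 = 0 := by rw [z₂] at q₂; linarith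
    intro i
    fin_cases i <;> assumption
  have hspan := hli.span_eq_top_of_card_eq_finrank (by simp [hE])
  have hw : w ∈ Submodule.span ℝ (Set.range ![x₁, x₂, j x₁, j x₂]) := hspan ▸ Submodule.mem_top
  obtain ⟨a, ha⟩ := (Submodule.mem_span_range_iff_exists_fun ℝ).1 hw
  simp only [Fin.sum_univ_four, Matrix.cons_val] at ha
  subst ha
  simp only [map_add, map_smul, add_apply, smul_apply, smul_eq_mul,
    h₁, h₂, h₁₂, h₂₁, j₁₁, j₁₂, j₂₁, j₂₂, k₁₁, o₁₁, o₂₁, k₂₁] at w₁ w₂ wj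
  have r₃ : a 3 * (1 + s ^ 2) = 0 := by linear_combination s * w₁ - wj
  have z₃ : a 3 = 0 := (mul_eq_zero.1 r₃).resolve_right hs.ne'
  have z₁ : a 1 = 0 := by rw [z₃] at w₁; linarith
  have z₀ : a 0 = -s * a 2 := by linarith
  refine ⟨a 2, ?_⟩
  rw [z₀, z₁, z₃]
  module

end NullBasis

/-! ### Slant surfaces in Kähler domains. -/

section SlantSurface

variable {E : Type*} [NormedAddCommGroup E] [NormedSpace ℝ E]
  {E' : Type*} [NormedAddCommGroup E'] [NormedSpace ℝ E']

/-- A coordinate immersion into a domain with an orthogonal, parallel complex structure `J`. -/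
structure IsKahlerImmersion (U : Set E) (V : Set E') (G : E → E →L[ℝ] E →L[ℝ] ℝ)
    (G' : E' → E' →L[ℝ] E' →L[ℝ] ℝ) (J : E' → E' →L[ℝ] E') (F : E → E') : Prop
    extends IsCoordinateImmersion U V G G' F where
  smooth_endo : ContDiffOn ℝ ∞ J V
  sq : ∀ y ∈ V, ∀ u, J y (J y u) = -u
  orthogonal : ∀ y ∈ V, ∀ u v, G' y (J y u) (J y v) = G' y u v
  parallel : ∀ y ∈ V, ∀ u v, covDerivEndo G' J y u v = 0

/-- The two-form `(u, v) ↦ ⟨J dF u, dF v⟩`. -/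
def kahlerForm (G' : E' → E' →L[ℝ] E' →L[ℝ] ℝ) (J : E' → E' →L[ℝ] E') (F : E → E') (y : E) :
    E →L[ℝ] E →L[ℝ] ℝ :=
  (G' (F y)).bilinearComp ((J (F y)).comp (fderiv ℝ F y)) (fderiv ℝ F y)

theorem kahlerForm_apply (G' : E' → E' →L[ℝ] E' →L[ℝ] ℝ) (J : E' → E' →L[ℝ] E') (F : E → E')
    (y u v : E) :
    kahlerForm G' J F y u v = G' (F y) (J (F y) (fderiv ℝ F y u)) (fderiv ℝ F y v) := rfl

/-- A null basis at `y` on which the Kähler form takes the value `-s`. -/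
def IsSlantBasis (G : E → E →L[ℝ] E →L[ℝ] ℝ) (G' : E' → E' →L[ℝ] E' →L[ℝ] ℝ)
    (J : E' → E' →L[ℝ] E') (F : E → E') (s : ℝ) (y e₁ e₂ : E) : Prop :=
  G y e₁ e₁ = 0 ∧ G y e₂ e₂ = 0 ∧ G y e₁ e₂ = -1 ∧ kahlerForm G' J F y e₁ e₂ = -s

namespace IsKahlerImmersion

variable {U : Set E} {V : Set E'} {G : E → E →L[ℝ] E →L[ℝ] ℝ}
  {G' : E' → E' →L[ℝ] E' →L[ℝ] ℝ} {J : E' → E' →L[ℝ] E'} {F : E → E'}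
  (H : IsKahlerImmersion U V G G' J F) {y : E} (hy : y ∈ U)

include H hy

theorem skew (u v : E') : G' (F y) (J (F y) u) v = -G' (F y) u (J (F y) v) := by
  have hF := H.mapsTo y hy
  rw [← H.orthogonal _ hF (J (F y) u) v, H.sq _ hF]
  simp

theorem kahlerForm_skew (u v : E) : kahlerForm G' J F y u v = -kahlerForm G' J F y v u := by
  rw [kahlerForm_apply, H.skew hy, H.symm_target _ (H.mapsTo y hy), kahlerForm_apply]

theorem differentiableAt_endo {W : E → E'} (hW : DifferentiableAt ℝ W y) :
    DifferentiableAt ℝ (fun z => J (F z) (W z)) y :=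
  (DifferentiableAt.comp y ((H.smooth_endo.contDiffAt (H.mem_nhds_target hy)).differentiableAt
    (by simp)) (H.differentiableAt hy)).clm_apply hW

theorem covDerivAlong_endo_apply {W : E → E'} (hW : DifferentiableAt ℝ W y) (x : E) :
    covDerivAlong G' F (fun z => J (F z) (W z)) y x = J (F y) (covDerivAlong G' F W y x) :=
  covDerivAlong_endo ((H.smooth_endo.contDiffAt (H.mem_nhds_target hy)).differentiableAt
    (by simp)) (H.parallel _ (H.mapsTo y hy)) (H.differentiableAt hy) hW x

variable [FiniteDimensional ℝ E']

/-- Since `J` is parallel, only the formula of Gauss contributes: its tangential part gives the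
connection terms, its normal part the two terms in `h`. -/
theorem fderiv_kahlerForm (x u v : E) :
    fderiv ℝ (fun z => kahlerForm G' J F z u v) y x
      = kahlerForm G' J F y (christoffel G y x u) v + kahlerForm G' J F y u (christoffel G y x v)
        - G' (F y) (secondFundamentalCLM G G' F y x u) (J (F y) (fderiv ℝ F y v))
        + G' (F y) (secondFundamentalCLM G G' F y x v) (J (F y) (fderiv ℝ F y u)) := by
  have hu := H.differentiableAt_fderiv hy u
  have hv := H.differentiableAt_fderiv hy v
  simp only [kahlerForm_apply]
  rw [H.fderiv_target_apply hy (H.differentiableAt_endo hy hu) hv,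
    H.covDerivAlong_endo_apply hy hu, H.covDerivAlong_fderiv hy, H.covDerivAlong_fderiv hy]
  simp only [map_add, add_apply]
  rw [H.skew hy (secondFundamentalCLM G G' F y x u),
    H.symm_target _ (H.mapsTo y hy) _ (secondFundamentalCLM G G' F y x v)]
  ring

omit [FiniteDimensional ℝ E'] in
theorem differentiableAt_kahlerForm (u v : E) :
    DifferentiableAt ℝ (fun z => kahlerForm G' J F z u v) y :=
  ((DifferentiableAt.comp y ((H.contDiffAt_target hy).differentiableAt (by simp))
    (H.differentiableAt hy)).clm_apply
      (H.differentiableAt_endo hy (H.differentiableAt_fderiv hy u))).clm_apply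
      (H.differentiableAt_fderiv hy v)

variable [FiniteDimensional ℝ E]

/-- For a properly slant surface, `⟨h(u, v), J w⟩` is totally symmetric. -/
theorem cubicForm_symm (hE : Module.finrank ℝ E = 2) {s : ℝ} (hs : s ≠ 0)
    (hslant : ∀ z ∈ U, ∃ e₁ e₂, IsSlantBasis G G' J F s z e₁ e₂) (x v w : E) :
    G' (F y) (secondFundamentalCLM G G' F y x v) (J (F y) (fderiv ℝ F y w))
      = G' (F y) (secondFundamentalCLM G G' F y x w) (J (F y) (fderiv ℝ F y v)) := by
  obtain ⟨e₁, e₂, h₁, h₂, h₁₂, ho⟩ := hslant y hy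
  have hexp := eq_smul_add_smul_of_null hE (H.symm hy) h₁ h₂ h₁₂
  have h₂₁ : G y e₂ e₁ = -1 := by rw [H.symm hy, h₁₂]
  have o₁ : kahlerForm G' J F y e₁ e₁ = 0 := by linarith [H.kahlerForm_skew hy e₁ e₁]
  have o₂ : kahlerForm G' J F y e₂ e₂ = 0 := by linarith [H.kahlerForm_skew hy e₂ e₂]
  -- The vectors `e₁, e₂` are kept fixed and are a null basis only at `y`. The squared relation
  -- holds near `y` whichever slant basis is chosen at each point.
  have hev : (fun z => kahlerForm G' J F z e₁ e₂ ^ 2) =ᶠ[nhds y]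
      fun z => s ^ 2 * (G z e₁ e₂ ^ 2 - G z e₁ e₁ * G z e₂ e₂) := by
    filter_upwards [H.mem_nhds hy] with z hz
    obtain ⟨f₁, f₂, k₁, k₂, k₁₂, ko⟩ := hslant z hz
    rw [sq_eq_of_null hE (H.symm hz) (H.kahlerForm_skew hz) k₁ k₂ k₁₂ e₁ e₂, ko]
    ring
  have hd := H.differentiableAt_kahlerForm hy e₁ e₂
  have hg₁₂ := H.differentiableAt_metric hy e₁ e₂
  have hg₁ := H.differentiableAt_metric hy e₁ e₁
  have hg₂ := H.differentiableAt_metric hy e₂ e₂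
  have hbase : G' (F y) (secondFundamentalCLM G G' F y x e₁) (J (F y) (fderiv ℝ F y e₂))
      = G' (F y) (secondFundamentalCLM G G' F y x e₂) (J (F y) (fderiv ℝ F y e₁)) := by
    have key := DFunLike.congr_fun (hev.fderiv_eq (𝕜 := ℝ)) x
    have l := (hd.hasFDerivAt.pow 2).fderiv
    have r₁ := hg₁₂.hasFDerivAt.pow 2
    have r₂ := hg₁.hasFDerivAt.mul hg₂.hasFDerivAt
    have r := ((r₁.sub r₂).const_mul (s ^ 2)).fderiv
    simp only [Pi.sub_def, Pi.mul_def] at l r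
    rw [l, r] at key
    simp [h₁, h₂, h₁₂, ho, H.fderiv_metric_apply hy] at key
    rw [H.fderiv_kahlerForm hy] at key
    -- At `y` the Kähler form agrees with `s G` when `e₂` is in the second slot or `e₁` in the
    -- first. The connection terms therefore cancel against those of the metric.
    have a₁ : kahlerForm G' J F y (christoffel G y x e₁) e₂
        = s * G y (christoffel G y x e₁) e₂ := by
      conv_lhs => rw [hexp (christoffel G y x e₁)]
      simp only [map_add, map_smul, add_apply, smul_apply, smul_eq_mul, ho, o₂]
      ring
    have a₂ : kahlerForm G' J F y e₁ (christoffel G y x e₂)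
        = s * G y e₁ (christoffel G y x e₂) := by
      conv_lhs => rw [hexp (christoffel G y x e₂)]
      simp only [map_add, map_smul, smul_eq_mul, ho, o₁]
      rw [H.symm hy e₁]
      ring
    rw [a₁, a₂] at key
    have h3 : s * (G' (F y) (secondFundamentalCLM G G' F y x e₁) (J (F y) (fderiv ℝ F y e₂))
      - G' (F y) (secondFundamentalCLM G G' F y x e₂) (J (F y) (fderiv ℝ F y e₁))) = 0 := by
      linear_combination (-1 / 2) * key
    exact sub_eq_zero.1 ((mul_eq_zero.1 h3).resolve_left hs)
  rw [hexp v, hexp w]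
  simp only [map_add, map_smul, add_apply, smul_apply, smul_eq_mul, hbase]
  ring

omit hy in
/-- A minimal flat slant surface in a complex space form which is not flat is Lagrangian. -/
theorem slant_eq_zero (hE : Module.finrank ℝ E = 2) (hE' : Module.finrank ℝ E' = 4) {c : ℝ}
    (hc : c ≠ 0) (hcurv : ∀ y ∈ V, ∀ u v w, curvature G' y u v w = c •
      (G' y v w • u - G' y u w • v + G' y (J y v) w • J y u - G' y (J y u) w • J y v
        + (2 * G' y u (J y v)) • J y w))
    (hmin : ∀ y ∈ U, meanCurvature G G' F y = 0)
    (hflat : ∀ y ∈ U, ∀ u v w, curvature G y u v w = 0) {s : ℝ}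
    (hslant : ∀ z ∈ U, ∃ e₁ e₂, IsSlantBasis G G' J F s z e₁ e₂) (hU : U.Nonempty) : s = 0 := by
  by_contra hs
  obtain ⟨y, hy⟩ := hU
  have hpoly : ∀ z ∈ U, ∃ e₁ e₂, IsSlantBasis G G' J F s z e₁ e₂ ∧
      secondFundamentalCLM G G' F z e₁ e₂ = 0 := by
    intro z hz
    obtain ⟨e₁, e₂, h₁, h₂, h₁₂, ho⟩ := hslant z hz
    refine ⟨e₁, e₂, ⟨h₁, h₂, h₁₂, ho⟩, ?_⟩
    have hm := hmin z hz
    rw [meanCurvature, hE, smul_eq_zero_iff_right (by norm_num)] at hm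
    have : secondFundamentalForm G G' F z = fun u v => secondFundamentalCLM G G' F z u v := by
      ext u v
      exact (H.secondFundamentalCLM_apply hz u v).symm
    rw [this, metricTrace_of_null hE (H.nondegenerate z hz) (H.symm hz) h₁ h₂ h₁₂,
      H.secondFundamentalCLM_symm hz e₂ e₁, neg_eq_zero, ← two_smul ℝ,
      smul_eq_zero_iff_right (by norm_num)] at hm
    exact hm
  obtain ⟨e₁, e₂, ⟨h₁, h₂, h₁₂, ho⟩, B₁₂⟩ := hpoly y hy
  have hFy := H.mapsTo y hy
  set B := secondFundamentalCLM G G' F with hB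
  set g := G' (F y) with hg
  set j := J (F y) with hj
  set T := fderiv ℝ F y with hT
  have hexp := eq_smul_add_smul_of_null hE (H.symm hy) h₁ h₂ h₁₂
  have h₂₁ : G y e₂ e₁ = -1 := by rw [H.symm hy, h₁₂]
  have B₂₁ : B y e₂ e₁ = 0 := by rw [H.secondFundamentalCLM_symm hy, B₁₂]
  have gsymm : ∀ u v, g u v = g v u := H.symm_target _ hFy
  have gT : ∀ u v, g (T u) (T v) = G y u v := fun u v => (H.induced y hy u v).symm
  have j₁₁ : g (j (T e₁)) (T e₁) = 0 := by
    have := H.kahlerForm_skew hy e₁ e₁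
    rw [kahlerForm_apply] at this
    linarith
  have j₂₂ : g (j (T e₂)) (T e₂) = 0 := by
    have := H.kahlerForm_skew hy e₂ e₂
    rw [kahlerForm_apply] at this
    linarith
  have j₁₂ : g (j (T e₁)) (T e₂) = -s := ho
  have j₂₁ : g (j (T e₂)) (T e₁) = s := by
    have := H.kahlerForm_skew hy e₂ e₁
    rw [ho, neg_neg] at this
    exact this
  have hnormal : ∀ u v w, g (B y u v) (T w) = 0 := H.inner_secondFundamental_fderiv hy
  have hσ := H.cubicForm_symm hy hE hs hslant
  have hdB := H.differentiableAt_secondFundamental hy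
  have hdT := H.differentiableAt_fderiv hy
  have hdJT := fun v => H.differentiableAt_endo hy (hdT v)
  have hJT : ∀ x v, covDerivAlong G' F (fun z => J (F z) (fderiv ℝ F z v)) y x
      = j (T (christoffel G y x v)) + j (B y x v) := by
    intro x v
    rw [H.covDerivAlong_endo_apply hy (hdT v), H.covDerivAlong_fderiv hy, map_add]
  -- The full ambient derivative of `h` on constant vectors: it has a tangential part, and its
  -- connection corrections in `u, v` are kept separate.
  set A : E → E → E → E' := fun x u v => covDerivAlong G' F (fun z => B z u v) y x with hA
  have hAsymm : ∀ x u v, A x u v = A x v u := by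
    intro x u v
    have hev : (fun z => B z u v) =ᶠ[nhds y] fun z => B z v u := by
      filter_upwards [H.mem_nhds hy] with z hz using H.secondFundamentalCLM_symm hz u v
    simp only [hA, covDerivAlong]
    rw [hev.fderiv_eq, H.secondFundamentalCLM_symm hy u v]
  -- Weingarten: differentiate `⟨h(u, v), dF w⟩ = 0`.
  have hAT : ∀ x u v w, g (A x u v) (T w) = -g (B y u v) (B y x w) := by
    intro x u v w
    have hev : (fun z => G' (F z) (B z u v) (fderiv ℝ F z w)) =ᶠ[nhds y] fun _ => (0 : ℝ) := by
      filter_upwards [H.mem_nhds hy] with z hz using H.inner_secondFundamental_fderiv hz u v w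
    have h := DFunLike.congr_fun (hev.fderiv_eq (𝕜 := ℝ)) x
    rw [H.fderiv_target_apply hy (hdB u v) (hdT w), H.covDerivAlong_fderiv hy] at h
    simp only [map_add, fderiv_const_apply, zero_apply] at h
    have h' := hnormal u v (christoffel G y x w)
    simp only [hA]
    linarith
  -- Differentiate the total symmetry of `⟨h(u, v), J w⟩`, again using that `J` is parallel.
  have hAσ : ∀ x u v w, g (A x u v) (j (T w)) + g (B y u v) (j (T (christoffel G y x w)))
        + g (B y u v) (j (B y x w))
      = g (A x u w) (j (T v)) + g (B y u w) (j (T (christoffel G y x v)))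
        + g (B y u w) (j (B y x v)) := by
    intro x u v w
    have hev : (fun z => G' (F z) (B z u v) (J (F z) (fderiv ℝ F z w))) =ᶠ[nhds y]
        fun z => G' (F z) (B z u w) (J (F z) (fderiv ℝ F z v)) := by
      filter_upwards [H.mem_nhds hy] with z hz using H.cubicForm_symm hz hE hs hslant u v w
    have h := DFunLike.congr_fun (hev.fderiv_eq (𝕜 := ℝ)) x
    rw [H.fderiv_target_apply hy (hdB u v) (hdJT w), H.fderiv_target_apply hy (hdB u w) (hdJT v),
      hJT, hJT] at h
    simp only [map_add] at h
    simp only [hA]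
    linarith
  have hAtr : ∀ x, A x e₁ e₂ = -(G y (christoffel G y x e₂) e₂ • B y e₁ e₁)
      - G y (christoffel G y x e₁) e₁ • B y e₂ e₂ := by
    intro x
    -- Minimality as an identity in the fixed vectors, which need not be null away from `y`. Its
    -- derivative at `y` carries an overall factor `2`, removed below.
    have hev : (fun z => G z e₂ e₂ • B z e₁ e₁ - (2 * G z e₁ e₂) • B z e₁ e₂
        + G z e₁ e₁ • B z e₂ e₂) =ᶠ[nhds y] fun _ => (0 : E') := by
      filter_upwards [H.mem_nhds hy] with z hz
      obtain ⟨f₁, f₂, ⟨k₁, k₂, k₁₂, -⟩, kB⟩ := hpoly z hz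
      exact trace_free_polynomial hE (H.symm hz) k₁ k₂ k₁₂ kB
        (by rw [H.secondFundamentalCLM_symm hz, kB]) e₁ e₂
    have h := DFunLike.congr_fun (hev.fderiv_eq (𝕜 := ℝ)) x
    have hm := H.differentiableAt_metric hy
    have l₁ := (hm e₂ e₂).hasFDerivAt.smul (hdB e₁ e₁).hasFDerivAt
    have l₂ := ((hm e₁ e₂).hasFDerivAt.const_mul 2).smul (hdB e₁ e₂).hasFDerivAt
    have l₃ := (hm e₁ e₁).hasFDerivAt.smul (hdB e₂ e₂).hasFDerivAt
    have l := ((l₁.sub l₂).add l₃).fderiv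
    simp only [Pi.smul_def', Pi.sub_def, Pi.add_def] at l
    rw [l] at h
    simp [h₁, h₂, h₁₂, ← hB, B₁₂, H.fderiv_metric_apply hy,
      H.symm hy _ (christoffel G y x _)] at h
    have hA12 : A x e₁ e₂ = fderiv ℝ (fun z => B z e₁ e₂) y x := by
      simp [hA, covDerivAlong, B₁₂, ← christoffelCLM_apply]
    rw [hA12]
    have h' := congrArg (fun w => (2⁻¹ : ℝ) • w) h
    simp only [smul_zero] at h'
    rw [← sub_eq_zero, ← h']
    module
  have hcod := H.gauss_codazzi hy e₁ e₂ e₁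
  rw [hflat y hy, map_zero, sub_zero, hcurv _ hFy, ← hB, ← hT] at hcod
  change A e₁ e₂ e₁ - A e₂ e₁ e₁ + B y e₁ (christoffel G y e₂ e₁)
    - B y e₂ (christoffel G y e₁ e₁) = _ at hcod
  have k₁₂ : g (T e₁) (j (T e₂)) = s := by rw [gsymm, j₂₁]
  have o₁₂ : g (j (T e₁)) (j (T e₂)) = -1 := by
    rw [H.orthogonal _ hFy, gT, h₁₂]
  have o₂₂ : g (j (T e₂)) (j (T e₂)) = 0 := by
    rw [H.orthogonal _ hFy, gT, h₂]
  have t₁₁ : g (T e₁) (T e₁) = 0 := by rw [gT, h₁]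
  have t₂₂ : g (T e₂) (T e₂) = 0 := by rw [gT, h₂]
  have t₁₂ : g (T e₁) (T e₂) = -1 := by rw [gT, h₁₂]
  have t₂₁ : g (T e₂) (T e₁) = -1 := by rw [gT, h₂₁]
  rw [← hg, ← hj, t₁₁, t₂₁, j₂₁, j₁₁, k₁₂] at hcod
  -- Pairing with the tangent vector `e₂` kills the terms in `h` itself; Weingarten leaves a single
  -- product.
  have gauss : g (B y e₁ e₁) (B y e₂ e₂) = c * (1 - 3 * s ^ 2) := by
    have h := congrArg (fun w => g w (T e₂)) hcod
    simp only [map_add, map_sub, map_smul, add_apply, sub_apply, smul_apply, smul_eq_mul,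
      hAT, hnormal, B₂₁, j₁₂, t₁₂, t₂₂, j₂₂, map_zero, zero_apply] at h
    linear_combination h
  -- `J e₂` is not normal when `s ≠ 0`, so this pairing mixes the tangential and normal equations
  -- and needs no normal connection. All Christoffel terms cancel.
  have codazzi : g (B y e₁ e₁) (j (B y e₂ e₂)) = -4 * c * s := by
    have h := congrArg (fun w => g w (j (T e₂))) hcod
    -- The differentiated symmetry moves `e₂` from the `J` slot into `h`, where the differentiated
    -- trace condition evaluates the result.
    have c₁ : g (A e₂ e₁ e₁) (j (T e₂)) = -g (B y e₁ e₁) (j (B y e₂ e₂)) := by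
      have h1 := hAσ e₂ e₁ e₁ e₂
      have h2 : g (B y e₂ e₂) (j (T e₁)) = 0 := by
        have := hσ e₂ e₂ e₁
        rwa [← hB, ← hg, ← hj, ← hT, B₂₁, map_zero, zero_apply] at this
      rw [hAtr, B₁₂, hexp (christoffel G y e₂ e₂)] at h1
      have h3 : g (B y e₁ e₁) (j (T e₂)) = 0 := by
        have := hσ e₁ e₁ e₂
        rwa [← hB, ← hg, ← hj, ← hT, B₁₂, map_zero, zero_apply] at this
      simp [h₂, h₁₂, h2, h3] at h1
      linarith
    have h3 : g (B y e₁ e₁) (j (T e₂)) = 0 := by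
      have := hσ e₁ e₁ e₂
      rwa [← hB, ← hg, ← hj, ← hT, B₁₂, map_zero, zero_apply] at this
    have c₂ : B y e₁ (christoffel G y e₂ e₁) = -G y (christoffel G y e₂ e₁) e₂ • B y e₁ e₁ := by
      conv_lhs => rw [hexp (christoffel G y e₂ e₁)]
      simp only [map_add, map_smul, B₁₂, smul_zero, add_zero]
    have c₃ : B y e₂ (christoffel G y e₁ e₁) = -G y (christoffel G y e₁ e₁) e₁ • B y e₂ e₂ := by
      conv_lhs => rw [hexp (christoffel G y e₁ e₁)]
      simp only [map_add, map_smul, B₂₁, smul_zero, zero_add]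
    simp only [map_add, map_sub, map_smul, map_neg, add_apply, sub_apply, smul_apply, neg_apply,
      smul_eq_mul, hAsymm e₁ e₂ e₁, hAtr, c₁, c₂, c₃, h3, k₁₂, o₁₂, o₂₂, gsymm (T e₂) (j (T e₂)),
      j₂₂] at h
    linear_combination h
  obtain ⟨b, hb⟩ := exists_eq_smul_of_orthogonal hE' gsymm (H.orthogonal _ hFy) t₁₁ t₂₂ t₁₂
    j₁₁ j₂₂ j₁₂ j₂₁ (hnormal e₂ e₂ e₁) (hnormal e₂ e₂ e₂) (by
      have := hσ e₂ e₂ e₁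
      rwa [← hB, ← hg, ← hj, ← hT, B₂₁, map_zero, zero_apply] at this)
  have hjj : j (j (T e₁)) = -T e₁ := H.sq _ hFy _
  -- With `h(e₂, e₂) = b (J e₁ - s e₁)`, its image under `J` is `-b (e₁ + s J e₁)`, and `h(e₁, e₁)`
  -- is orthogonal to `e₁`.
  have final : g (B y e₁ e₁) (j (B y e₂ e₂)) + s * g (B y e₁ e₁) (B y e₂ e₂) = 0 := by
    rw [hb, ← hj]
    simp only [map_smul, map_sub, map_neg, smul_eq_mul, hjj, hnormal]
    ring
  rw [gauss, codazzi] at final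
  have h3 : c * s * (3 * (1 + s ^ 2)) = 0 := by linear_combination -final
  rcases mul_eq_zero.1 h3 with h | h
  · exact (mul_ne_zero hc hs) h
  · nlinarith [sq_nonneg s]

end IsKahlerImmersion

end SlantSurface

/-! ### Existence of null bases. -/

section NullBasisExistence

variable {E : Type*} [NormedAddCommGroup E] [NormedSpace ℝ E]

/-- A Lorentzian plane has a null basis. -/
theorem exists_null_basis (hE : Module.finrank ℝ E = 2) {B : E →L[ℝ] E →L[ℝ] ℝ}
    (hsymm : ∀ u v, B u v = B v u) (hnd : ∀ u, (∀ v, B u v = 0) → u = 0)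
    (hneg : ∃ u, B u u < 0) (hindex : ¬ ∀ u, u ≠ 0 → B u u < 0) :
    ∃ e₁ e₂, B e₁ e₁ = 0 ∧ B e₂ e₂ = 0 ∧ B e₁ e₂ = -1 := by
  have : FiniteDimensional ℝ E := Module.finite_of_finrank_pos (by omega)
  obtain ⟨u, hu⟩ := hneg
  obtain ⟨v, hv, hv0⟩ := Submodule.exists_mem_ne_zero_of_ne_bot
    (LinearMap.ker_ne_bot_of_finrank_lt (f := (B u : E →ₗ[ℝ] ℝ)) (by simp [hE]))
  have huv : B u v = 0 := hv
  have hvu : B v u = 0 := by rw [hsymm, huv]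
  have hli : LinearIndependent ℝ ![u, v] := by
    rw [LinearIndependent.pair_iff]
    intro a b hab
    have h1 := congrArg (fun w => B w u) hab
    simp [hvu, hu.ne] at h1
    subst h1
    simpa [hv0] using hab
  have hspan := hli.span_eq_top_of_card_eq_finrank (by simp [hE])
  have hexp : ∀ w, ∃ a b : ℝ, a • u + b • v = w := by
    intro w
    have hw : w ∈ Submodule.span ℝ (Set.range ![u, v]) := hspan ▸ Submodule.mem_top
    simp only [Matrix.range_cons, Matrix.range_empty, Set.union_empty,
      Set.singleton_union] at hw
    exact Submodule.mem_span_pair.1 hw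
  -- If `B v v < 0` the form would be negative definite; if `B v v = 0` then `v` would lie in its
  -- radical.
  have hvv : 0 < B v v := by
    rcases lt_trichotomy (B v v) 0 with h | h | h
    · refine absurd (fun w hw => ?_) hindex
      obtain ⟨a, b, rfl⟩ := hexp w
      have hab : a ≠ 0 ∨ b ≠ 0 := by
        by_contra! hab
        simp [hab] at hw
      simp only [map_add, map_smul, add_apply, smul_apply, smul_eq_mul, huv, hvu]
      rcases hab with ha | hb
      · nlinarith [mul_pos_of_neg_of_neg (neg_lt_zero.2 (sq_pos_of_ne_zero ha)) hu, sq_nonneg b]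
      · nlinarith [mul_pos_of_neg_of_neg (neg_lt_zero.2 (sq_pos_of_ne_zero hb)) h, sq_nonneg a]
    · refine absurd (hnd v fun w => ?_) hv0
      obtain ⟨a, b, rfl⟩ := hexp w
      simp [hvu, h]
    · exact h
  set a := √(-B u u)
  set b := √(B v v)
  have ha : a ^ 2 = -B u u := Real.sq_sqrt (by linarith)
  have hb : b ^ 2 = B v v := Real.sq_sqrt hvv.le
  have ha0 : a ≠ 0 := (Real.sqrt_pos.2 (by linarith)).ne'
  have hb0 : b ≠ 0 := (Real.sqrt_pos.2 hvv).ne'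
  have hu' : B u u = -a ^ 2 := by linarith
  -- Sum and half-difference of the normalized timelike and spacelike vectors, scaled so that the
  -- product is `-1`.
  refine ⟨a⁻¹ • u + b⁻¹ • v, (2 * a)⁻¹ • u - (2 * b)⁻¹ • v, ?_, ?_, ?_⟩ <;>
  · simp only [map_add, map_sub, map_smul, add_apply, sub_apply, smul_apply, smul_eq_mul, huv, hvu,
      hu', ← hb]
    field_simp
    ring

end NullBasisExistence

/-! ### From manifolds to coordinate domains. -/

section Charts

variable {E : Type*} [NormedAddCommGroup E] [NormedSpace ℝ E]
  {M : Type*} [TopologicalSpace M] [ChartedSpace E M]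

section

variable {e : OpenPartialHomeomorph M E} (he : e.MDifferentiable 𝓘(ℝ, E) 𝓘(ℝ, E))
  {p : M} (hp : p ∈ e.source)

include he hp

theorem mfderiv_symm_mfderiv (X : TangentSpace 𝓘(ℝ, E) p) :
    (mfderiv 𝓘(ℝ, E) 𝓘(ℝ, E) e.symm (e p) (mfderiv 𝓘(ℝ, E) 𝓘(ℝ, E) e p X) : E) = X :=
  DFunLike.congr_fun (he.symm_comp_deriv hp) X

theorem mfderiv_mfderiv_symm (u : E) :
    (mfderiv 𝓘(ℝ, E) 𝓘(ℝ, E) e p (mfderiv 𝓘(ℝ, E) 𝓘(ℝ, E) e.symm (e p) u : E) : E) = u := by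
  have h := DFunLike.congr_fun (he.comp_symm_deriv (e.map_source hp)) u
  rw [e.left_inv hp] at h
  exact h

theorem inChart_mfderiv (g : BilinField E M) (X Y : TangentSpace 𝓘(ℝ, E) p) :
    g.inChart e (e p) (mfderiv 𝓘(ℝ, E) 𝓘(ℝ, E) e p X) (mfderiv 𝓘(ℝ, E) 𝓘(ℝ, E) e p Y)
      = g p X Y := by
  -- `e.symm (e p)` equals `p` only propositionally, which changes the tangent space in the type.
  -- Viewing every fibre as `E` and substituting for a general `q` makes the transport trivial.
  have key : ∀ q : M, q = p → ∀ a b : E, (g q : E →L[ℝ] E →L[ℝ] ℝ) a b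
      = (g p : E →L[ℝ] E →L[ℝ] ℝ) a b := by
    rintro _ rfl _ _
    rfl
  refine (key _ (e.left_inv hp) _ _).trans ?_
  exact congrArg₂ (fun a b : E => (g p : E →L[ℝ] E →L[ℝ] ℝ) a b)
    (mfderiv_symm_mfderiv he hp X) (mfderiv_symm_mfderiv he hp Y)

theorem endo_inChart_mfderiv (J : EndoField E M) (X : TangentSpace 𝓘(ℝ, E) p) :
    J.inChart e (e p) (mfderiv 𝓘(ℝ, E) 𝓘(ℝ, E) e p X)
      = mfderiv 𝓘(ℝ, E) 𝓘(ℝ, E) e p (J p X) := by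
  have key : ∀ q : M, q = p → ∀ a : E,
      (mfderiv 𝓘(ℝ, E) 𝓘(ℝ, E) e q ((J q : E →L[ℝ] E) a : E) : E)
      = mfderiv 𝓘(ℝ, E) 𝓘(ℝ, E) e p ((J p : E →L[ℝ] E) a : E) := by
    rintro _ rfl _
    rfl
  refine (key _ (e.left_inv hp) _).trans ?_
  exact congrArg (fun a : E => (mfderiv 𝓘(ℝ, E) 𝓘(ℝ, E) e p ((J p : E →L[ℝ] E) a : E) : E))
    (mfderiv_symm_mfderiv he hp X)

end

variable {E' : Type*} [NormedAddCommGroup E'] [NormedSpace ℝ E']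
  {N : Type*} [TopologicalSpace N] [ChartedSpace E' N]

/-- The domain of the coordinate expression of `f` in the charts `e` and `e'`. -/
def chartDomain (f : M → N) (e : OpenPartialHomeomorph M E) (e' : OpenPartialHomeomorph N E') :
    Set E :=
  e.target ∩ e.symm ⁻¹' (f ⁻¹' e'.source)

section Immersion

variable [IsManifold 𝓘(ℝ, E) ∞ M] [IsManifold 𝓘(ℝ, E') ∞ N]
  {f : M → N} (hf : ContMDiff 𝓘(ℝ, E) 𝓘(ℝ, E') ∞ f) (x₀ : M) (q₀ : N)

include hf

theorem fderiv_coordinates {p : M} (hp : p ∈ (chartAt E x₀).source)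
    (hq : f p ∈ (chartAt E' q₀).source) (u : E) :
    fderiv ℝ (fun z => chartAt E' q₀ (f ((chartAt E x₀).symm z))) (chartAt E x₀ p) u
      = mfderiv 𝓘(ℝ, E') 𝓘(ℝ, E') (chartAt E' q₀) (f p) (mfderiv 𝓘(ℝ, E) 𝓘(ℝ, E') f p
        (mfderiv 𝓘(ℝ, E) 𝓘(ℝ, E) (chartAt E x₀).symm (chartAt E x₀ p) u : E)) := by
  set e := chartAt E x₀
  set e' := chartAt E' q₀
  have he : e.MDifferentiable 𝓘(ℝ, E) 𝓘(ℝ, E) := mdifferentiable_chart x₀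
  have he' : e'.MDifferentiable 𝓘(ℝ, E') 𝓘(ℝ, E') := mdifferentiable_chart q₀
  have h1 : HasMFDerivAt 𝓘(ℝ, E) 𝓘(ℝ, E) e.symm (e p)
      (mfderiv 𝓘(ℝ, E) 𝓘(ℝ, E) e.symm (e p)) :=
    (he.mdifferentiableAt_symm (e.map_source hp)).hasMFDerivAt
  have h2 : HasMFDerivAt 𝓘(ℝ, E) 𝓘(ℝ, E') f (e.symm (e p))
      (mfderiv 𝓘(ℝ, E) 𝓘(ℝ, E') f (e.symm (e p))) :=
    (hf.mdifferentiable (by simp) _).hasMFDerivAt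
  have h3 : HasMFDerivAt 𝓘(ℝ, E') 𝓘(ℝ, E') e' (f (e.symm (e p)))
      (mfderiv 𝓘(ℝ, E') 𝓘(ℝ, E') e' (f (e.symm (e p)))) :=
    (he'.mdifferentiableAt (by rwa [e.left_inv hp])).hasMFDerivAt
  have h := (h3.comp (e p) (h2.comp (e p) h1)).mfderiv
  have key : ∀ q : M, q = p → ∀ a : E,
      (mfderiv 𝓘(ℝ, E') 𝓘(ℝ, E') e' (f q) (mfderiv 𝓘(ℝ, E) 𝓘(ℝ, E') f q a : E') : E')
      = mfderiv 𝓘(ℝ, E') 𝓘(ℝ, E') e' (f p) (mfderiv 𝓘(ℝ, E) 𝓘(ℝ, E') f p a : E') := by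
    rintro _ rfl _
    rfl
  rw [mfderiv_eq_fderiv] at h
  exact (DFunLike.congr_fun h u).trans (key _ (e.left_inv hp) _)

theorem contDiffOn_coordinates :
    ContDiffOn ℝ ∞ (fun z => chartAt E' q₀ (f ((chartAt E x₀).symm z)))
      (chartDomain f (chartAt E x₀) (chartAt E' q₀)) := by
  rw [← contMDiffOn_iff_contDiffOn]
  have h1 : ContMDiffOn 𝓘(ℝ, E) 𝓘(ℝ, E) ∞ (chartAt E x₀).symm
      (chartDomain f (chartAt E x₀) (chartAt E' q₀)) :=
    (contMDiffOn_chart_symm (I := 𝓘(ℝ, E))).mono Set.inter_subset_left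
  exact (contMDiffOn_chart (I := 𝓘(ℝ, E'))).comp (hf.comp_contMDiffOn h1) fun z hz => hz.2

omit [IsManifold 𝓘(ℝ, E) ∞ M] [IsManifold 𝓘(ℝ, E') ∞ N] in
theorem isOpen_chartDomain :
    IsOpen (chartDomain f (chartAt E x₀) (chartAt E' q₀)) :=
  (chartAt E x₀).isOpen_inter_preimage_symm
    ((chartAt E' q₀).open_source.preimage hf.continuous)

end Immersion

variable [IsManifold 𝓘(ℝ, E) ∞ M] [IsManifold 𝓘(ℝ, E') ∞ N]

/-- The coordinate expression of an immersion into a Kähler manifold. -/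
theorem isKahlerImmersion_coordinates {g : BilinField E' N} {J : EndoField E' N}
    (hN : IsKahler g J) {f : M → N} (hf : IsLorentzianImmersion (E := E) g f) (x₀ : M) (q₀ : N) :
    IsKahlerImmersion (chartDomain f (chartAt E x₀) (chartAt E' q₀)) (chartAt E' q₀).target
      ((inducedMetric (E := E) g f).inChart (chartAt E x₀)) (g.inChart (chartAt E' q₀))
      (J.inChart (chartAt E' q₀)) (fun z => chartAt E' q₀ (f ((chartAt E x₀).symm z))) := by
  have hF := @fderiv_coordinates E _ _ M _ _ E' _ _ N _ _ _ _ f hf.smooth x₀ q₀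
  have hopen := isOpen_chartDomain hf.smooth x₀ q₀
  have hsmooth := contDiffOn_coordinates hf.smooth x₀ q₀
  have hec := IsManifold.chart_mem_maximalAtlas (I := 𝓘(ℝ, E')) (n := ∞) q₀
  have he : (chartAt E x₀).MDifferentiable 𝓘(ℝ, E) 𝓘(ℝ, E) := mdifferentiable_chart x₀
  have he' : (chartAt E' q₀).MDifferentiable 𝓘(ℝ, E') 𝓘(ℝ, E') := mdifferentiable_chart q₀
  set e := chartAt E x₀
  set e' := chartAt E' q₀
  have hpt : ∀ y ∈ e'.target, ∃ q ∈ e'.source, e' q = y := fun y hy =>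
    ⟨e'.symm y, e'.map_target hy, e'.right_inv hy⟩
  have hvec : ∀ q ∈ e'.source, ∀ u : E', ∃ X : TangentSpace 𝓘(ℝ, E') q,
      mfderiv 𝓘(ℝ, E') 𝓘(ℝ, E') e' q X = u := fun q hq u =>
    ⟨_, mfderiv_mfderiv_symm he' hq u⟩
  refine
    { isOpen_source := hopen
      isOpen_target := e'.open_target
      mapsTo := fun y hy => e'.map_source hy.2
      smooth := hsmooth
      smooth_target := hN.metric.smooth e' hec
      symm_target := fun y hy u v => hN.metric.symm _ _ _
      nondegenerate_target := ?_
      induced := ?_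
      nondegenerate := ?_
      smooth_endo := hN.smooth e' hec
      sq := ?_
      orthogonal := ?_
      parallel := fun y hy u v => hN.parallel e' hec y hy u v }
  · intro y hy u hu
    obtain ⟨q, hq, rfl⟩ := hpt y hy
    obtain ⟨X, rfl⟩ := hvec q hq u
    have : X = 0 := hN.metric.nondegenerate q X fun Y =>
      (inChart_mfderiv he' hq g X Y).symm.trans (hu _)
    rw [this, map_zero]
    rfl
  · intro z hz u v
    obtain ⟨p, hp, rfl⟩ : ∃ p ∈ e.source, e p = z :=
      ⟨e.symm z, e.map_target hz.1, e.right_inv hz.1⟩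
    have hq : f p ∈ e'.source := by
      have := hz.2
      simpa [e.left_inv hp] using this
    have key : ∀ q : M, q = p → ∀ a b : E,
        (inducedMetric (E := E) g f q : E →L[ℝ] E →L[ℝ] ℝ) a b
        = (inducedMetric (E := E) g f p : E →L[ℝ] E →L[ℝ] ℝ) a b := by
      rintro _ rfl _ _
      rfl
    rw [hF hp hq, hF hp hq]
    simp only [e.left_inv hp]
    rw [inChart_mfderiv he' hq]
    exact key _ (e.left_inv hp) _ _
  · intro z hz u hu
    obtain ⟨p, hp, rfl⟩ : ∃ p ∈ e.source, e p = z :=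
      ⟨e.symm z, e.map_target hz.1, e.right_inv hz.1⟩
    have hX : (mfderiv 𝓘(ℝ, E) 𝓘(ℝ, E) e.symm (e p) u : E) = 0 :=
      hf.nondegenerate p _ fun Y =>
        (inChart_mfderiv he hp (inducedMetric (E := E) g f) _ Y).symm.trans
          ((congrArg (fun a : E => (inducedMetric (E := E) g f).inChart e (e p) a
            (mfderiv 𝓘(ℝ, E) 𝓘(ℝ, E) e p Y)) (mfderiv_mfderiv_symm he hp u)).trans (hu _))
    have h := mfderiv_mfderiv_symm he hp u
    rw [← h, hX]
    exact map_zero _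
  · intro y hy u
    obtain ⟨q, hq, rfl⟩ := hpt y hy
    obtain ⟨X, rfl⟩ := hvec q hq u
    rw [endo_inChart_mfderiv he' hq, endo_inChart_mfderiv he' hq, hN.sq, map_neg]
    rfl
  · intro y hy u v
    obtain ⟨q, hq, rfl⟩ := hpt y hy
    obtain ⟨X, rfl⟩ := hvec q hq u
    obtain ⟨Y, rfl⟩ := hvec q hq v
    rw [endo_inChart_mfderiv he' hq, endo_inChart_mfderiv he' hq, inChart_mfderiv he' hq,
      inChart_mfderiv he' hq, hN.orthogonal]

/-- The chart carries the slant basis over; `P e₁ = s e₁` paired with `e₂` gives the value `-s`. The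
condition on `P e₂` is not needed, by skewness of the Kähler form. -/
theorem exists_isSlantBasis_coordinates {g : BilinField E' N} {J : EndoField E' N}
    {f : M → N} (hf : IsLorentzianImmersion (E := E) g f) {θ : ℝ}
    (hθ : IsSlant (E := E) g J f θ) (x₀ : M) (q₀ : N) {z : E}
    (hz : z ∈ chartDomain f (chartAt E x₀) (chartAt E' q₀)) :
    ∃ e₁ e₂, IsSlantBasis ((inducedMetric (E := E) g f).inChart (chartAt E x₀))
      (g.inChart (chartAt E' q₀)) (J.inChart (chartAt E' q₀))
      (fun z => chartAt E' q₀ (f ((chartAt E x₀).symm z))) (Real.sinh θ) z e₁ e₂ := by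
  have hF := @fderiv_coordinates E _ _ M _ _ E' _ _ N _ _ _ _ f hf.smooth x₀ q₀
  have he : (chartAt E x₀).MDifferentiable 𝓘(ℝ, E) 𝓘(ℝ, E) := mdifferentiable_chart x₀
  have he' : (chartAt E' q₀).MDifferentiable 𝓘(ℝ, E') 𝓘(ℝ, E') := mdifferentiable_chart q₀
  set e := chartAt E x₀
  set e' := chartAt E' q₀
  obtain ⟨p, hp, rfl⟩ : ∃ p ∈ e.source, e p = z :=
    ⟨e.symm z, e.map_target hz.1, e.right_inv hz.1⟩
  have hq : f p ∈ e'.source := by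
    have := hz.2
    simpa [e.left_inv hp] using this
  obtain ⟨e₁, e₂, ⟨h₁, h₂, h₁₂⟩, t₁, -⟩ := hθ p
  refine ⟨mfderiv 𝓘(ℝ, E) 𝓘(ℝ, E) e p e₁, mfderiv 𝓘(ℝ, E) 𝓘(ℝ, E) e p e₂, ?_, ?_, ?_, ?_⟩
  · exact (inChart_mfderiv he hp _ _ _).trans h₁
  · exact (inChart_mfderiv he hp _ _ _).trans h₂
  · exact (inChart_mfderiv he hp _ _ _).trans h₁₂
  · have hd : ∀ X : TangentSpace 𝓘(ℝ, E) p,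
        fderiv ℝ (fun z => e' (f (e.symm z))) (e p) (mfderiv 𝓘(ℝ, E) 𝓘(ℝ, E) e p X)
        = mfderiv 𝓘(ℝ, E') 𝓘(ℝ, E') e' (f p) (mfderiv 𝓘(ℝ, E) 𝓘(ℝ, E') f p X) := fun X =>
      (hF hp hq _).trans (congrArg (fun a : E => (mfderiv 𝓘(ℝ, E') 𝓘(ℝ, E') e' (f p)
        (mfderiv 𝓘(ℝ, E) 𝓘(ℝ, E') f p a : E') : E')) (mfderiv_symm_mfderiv he hp X))
    have key : ∀ a b : E',
        a = mfderiv 𝓘(ℝ, E') 𝓘(ℝ, E') e' (f p) (mfderiv 𝓘(ℝ, E) 𝓘(ℝ, E') f p e₁) →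
        b = mfderiv 𝓘(ℝ, E') 𝓘(ℝ, E') e' (f p) (mfderiv 𝓘(ℝ, E) 𝓘(ℝ, E') f p e₂) →
        g.inChart e' (e' (f (e.symm (e p)))) (J.inChart e' (e' (f (e.symm (e p)))) a) b
          = g (f p) (J (f p) (mfderiv 𝓘(ℝ, E) 𝓘(ℝ, E') f p e₁))
            (mfderiv 𝓘(ℝ, E) 𝓘(ℝ, E') f p e₂) := by
      rintro _ _ rfl rfl
      rw [e.left_inv hp]
      exact (congrArg (fun c : E' => g.inChart e' (e' (f p)) c _)
        (endo_inChart_mfderiv he' hq J _)).trans (inChart_mfderiv he' hq g _ _)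
    refine (key _ _ (hd e₁) (hd e₂)).trans ?_
    have h := t₁ e₂
    rw [map_sub, map_smul, map_smul, sub_apply, smul_apply, sub_eq_zero] at h
    refine h.trans ?_
    have h₁₂' : g (f p) (mfderiv 𝓘(ℝ, E) 𝓘(ℝ, E') f p e₁) (mfderiv 𝓘(ℝ, E) 𝓘(ℝ, E') f p e₂)
      = -1 := h₁₂
    rw [h₁₂']
    simp

end Charts

end LorentzSurface

/-! ### The theorem on manifolds. -/

theorem lemma6p1
    {N : Type*} [TopologicalSpace N] [ChartedSpace (EuclideanSpace ℝ (Fin 4)) N]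
    [IsManifold 𝓘(ℝ, EuclideanSpace ℝ (Fin 4)) ∞ N]
    (g : LorentzSurface.BilinField (EuclideanSpace ℝ (Fin 4)) N)
    (J : LorentzSurface.EndoField (EuclideanSpace ℝ (Fin 4)) N)
    (c : ℝ) (hc : c ≠ 0) (hN : LorentzSurface.IsLorentzianComplexSpaceForm g J c)
    {M : Type*} [TopologicalSpace M] [ChartedSpace (EuclideanSpace ℝ (Fin 2)) M]
    [IsManifold 𝓘(ℝ, EuclideanSpace ℝ (Fin 2)) ∞ M] [Nonempty M]
    (f : M → N)
    (hf : LorentzSurface.IsLorentzianImmersion (E := EuclideanSpace ℝ (Fin 2)) g f)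
    (hmin : LorentzSurface.IsMinimal (E := EuclideanSpace ℝ (Fin 2)) g f)
    (hflat : LorentzSurface.IsFlat
      (LorentzSurface.inducedMetric (E := EuclideanSpace ℝ (Fin 2)) g f))
    (θ : ℝ) :
    LorentzSurface.IsSlant (E := EuclideanSpace ℝ (Fin 2)) g J f θ ↔
      θ = 0 ∧ LorentzSurface.IsLagrangian (E := EuclideanSpace ℝ (Fin 2)) g J f := by
  have hsymm : ∀ (x : M) (u v : TangentSpace 𝓘(ℝ, EuclideanSpace ℝ (Fin 2)) x),
      LorentzSurface.inducedMetric (E := EuclideanSpace ℝ (Fin 2)) g f x u v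
        = LorentzSurface.inducedMetric (E := EuclideanSpace ℝ (Fin 2)) g f x v u :=
    fun x u v => hN.kahler.metric.symm _ _ _
  have hE : Module.finrank ℝ (EuclideanSpace ℝ (Fin 2)) = 2 := by simp
  constructor
  · intro hθ
    have h0 : Real.sinh θ = 0 := by
      obtain ⟨x₀⟩ := ‹Nonempty M›
      have hec := IsManifold.chart_mem_maximalAtlas
        (I := 𝓘(ℝ, EuclideanSpace ℝ (Fin 2))) (n := ∞) x₀
      have hec' := IsManifold.chart_mem_maximalAtlas
        (I := 𝓘(ℝ, EuclideanSpace ℝ (Fin 4))) (n := ∞) (f x₀)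
      -- The angle is constant, so one pair of charts around a single point decides it.
      refine (LorentzSurface.isKahlerImmersion_coordinates hN.kahler hf x₀ (f x₀)).slant_eq_zero
        hE (by simp) hc (fun y hy => hN.curvature_eq _ hec' y hy)
        (fun y hy => hmin _ hec _ hec' y hy.1 hy.2)
        (fun y hy => hflat _ hec y hy.1)
        (fun z hz => LorentzSurface.exists_isSlantBasis_coordinates hf hθ x₀ (f x₀) hz)
        ⟨chartAt _ x₀ x₀, mem_chart_target _ x₀, ?_⟩
      simp [(chartAt _ x₀).left_inv (mem_chart_source _ x₀)]
    refine ⟨Real.sinh_eq_zero.1 h0, fun x u w => ?_⟩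
    obtain ⟨e₁, e₂, ⟨h₁, h₂, h₁₂⟩, t₁, t₂⟩ := hθ x
    have k₁ := t₁ w
    have k₂ := t₂ w
    rw [h0] at k₁ k₂
    simp only [neg_zero, zero_smul, map_zero, sub_zero] at k₁ k₂
    obtain ⟨a, b, rfl⟩ : ∃ a b : ℝ, u = a • e₁ + b • e₂ :=
      ⟨_, _, LorentzSurface.eq_smul_add_smul_of_null
        (E := EuclideanSpace ℝ (Fin 2)) hE (hsymm x) h₁ h₂ h₁₂ u⟩
    simp only [map_add, map_smul, add_apply, smul_apply, k₁, k₂, smul_zero, add_zero]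
  · rintro ⟨rfl, hL⟩ x
    obtain ⟨⟨W, hW, hW1⟩, hle⟩ := hf.index x
    obtain ⟨e₁, e₂, he⟩ : ∃ e₁ e₂ : TangentSpace 𝓘(ℝ, EuclideanSpace ℝ (Fin 2)) x,
        LorentzSurface.IsPseudoOrthonormal
          (LorentzSurface.inducedMetric (E := EuclideanSpace ℝ (Fin 2)) g f) x e₁ e₂ :=
      LorentzSurface.exists_null_basis (E := EuclideanSpace ℝ (Fin 2)) hE (hsymm x) (hf.nondegenerate x)
      (by
        have hWb : W ≠ ⊥ := by
          rintro rfl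
          simp at hW1
        obtain ⟨u, hu, hu0⟩ := Submodule.exists_mem_ne_zero_of_ne_bot hWb
        exact ⟨u, hW u hu hu0⟩)
      -- If the whole plane were negative definite, it would be a negative definite subspace of
      -- dimension `2`, exceeding the index.
      (fun h => by
        have h2 := hle ⊤ fun u _ hu => h u hu
        rw [finrank_top] at h2
        have h3 : Module.finrank ℝ (TangentSpace 𝓘(ℝ, EuclideanSpace ℝ (Fin 2)) x) = 2 := hE
        omega)
    refine ⟨e₁, e₂, he, fun w => ?_, fun w => ?_⟩
    · simpa using hL x e₁ w
    · simpa using hL x e₂ w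

end
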